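/- Let $\alpha=\frac{1+\sqrt5}{2}$, $\beta=\frac{1-\sqrt5}{2}$, $(q;q)_\infty=\prod_{n\ge1}(1-q^n)$ and, for $|q|<1$, $$A(q)=q^{1/5}(q;q)_\infty^{-3/5}\sum_{n=-\infty}^{\infty}(-1)^nq^{(5n^2-3n)/2},\qquad B(q)=(q;q)_\infty^{-3/5}\sum_{n=-\infty}^{\infty}(-1)^nq^{(5n^2-n)/2}.$$ With $A=A(q)$ and $B=B(q)$ put $$\mathcal A=\sqrt[5]{A^5-3A^4B+4A^3B^2-2A^2B^3+AB^4},\qquad \mathcal B=\sqrt[5]{B^5+3B^4A+4B^3A^2+2B^2A^3+BA^4},$$ $$\mathcal C=\frac{\sqrt[5]{B^5-\alpha^5A^5}-\sqrt[5]{B^5-\beta^5A^5}}{\beta-\alpha},\qquad \mathcal D=\frac{\beta\sqrt[5]{B^5-\alpha^5A^5}-\alpha\sqrt[5]{B^5-\beta^5A^5}}{\beta-\alpha}.$$ Then $$A(q^{1/5})=\mathcal A,\qquad B(q^{1/5})=\mathcal B,\qquad A(q^5)=\mathcal C,\qquad B(q^5)=\mathcal D$$ for all $q$ in the range considered. Consequently,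 if $\Omega$ is any function of three variables such that $\Omega(q,A(q),B(q))=0$ for all $q$ in this range, then $\Omega(q^{1/5},\mathcal A,\mathcal B)=0$ and $\Omega(q^5,\mathcal C,\mathcal D)=0$ for all $q$ in this range. These assertions hold in each of the following two settings. 1. *Real $q$.* Here $-1<q<1$, and all fifth roots (including $q^{1/5}$) are real fifth roots of real numbers; $\Omega$ is real-valued on $\mathbb R^3$. 2. *Complex $q$.* Here $q=e^{2\pi i\tau}$ with $\operatorname{Im}\tau>0$, and $A,B,\mathcal A,\mathcal B,\mathcal C,\mathcal D$ are functions of $\tau$; $q^{r}$ means $e^{2\pi ir\tau}$, so that replacing $q$ by $q^{1/5}$ or $q^5$ means replacing $\tau$ by $\tau/5$ or $5\tau$, and $(q;q)_\infty^{-3/5}$ is the branch holomorphic in $|q|<1$ with value $1$ at $q=0$. The function $\Omega$ is complex-valued on $\mathbb C^3$. The fifth roots in $\mathcal A,\mathcal B,\mathcal C,\mathcal D$ are the continuous functions of $\tau$ in the upper half-plane whose fifth powers are the radicands and which, as $\operatorname{Im}\tau\to\infty$, tend to $1$ in the case of $\sqrt[5]{B^5-\alpha^5A^5}$, $\sqrt[5]{B^5-\beta^5A^5}$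 and $\mathcal B$, and satisfy $\mathcal A/q^{1/25}\to1$ in the case of $\mathcal A$. Each of these four functions exists and is unique. -/

import Mathlib

open UpperHalfPlane Filter Topology

noncomputable section

namespace QuinticTheta

/-- The product `(q;q)_∞ = ∏_{n ≥ 1} (1 - q ^ n)`. -/
def qProd {𝕜 : Type*} [Field 𝕜] [TopologicalSpace 𝕜] (q : 𝕜) : 𝕜 :=
  ∏' n : ℕ, (1 - q ^ (n + 1))

/-- The series `∑_{n ∈ ℤ} (-1)^n q ^ ((5 n² - 3 n) / 2)`; the exponents are nonnegative integers,
so that the integer division is exact. -/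
def seriesA {𝕜 : Type*} [Field 𝕜] [TopologicalSpace 𝕜] (q : 𝕜) : 𝕜 :=
  ∑' n : ℤ, (-1 : 𝕜) ^ n * q ^ ((5 * n ^ 2 - 3 * n) / 2)

/-- The series `∑_{n ∈ ℤ} (-1)^n q ^ ((5 n² - n) / 2)`; the exponents are nonnegative integers,
so that the integer division is exact. -/
def seriesB {𝕜 : Type*} [Field 𝕜] [TopologicalSpace 𝕜] (q : 𝕜) : 𝕜 :=
  ∑' n : ℤ, (-1 : 𝕜) ^ n * q ^ ((5 * n ^ 2 - n) / 2)

/-- The form `a⁵ - 3a⁴b + 4a³b² - 2a²b³ + ab⁴`. -/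
def formA {R : Type*} [CommRing R] (a b : R) : R :=
  a ^ 5 - 3 * a ^ 4 * b + 4 * a ^ 3 * b ^ 2 - 2 * a ^ 2 * b ^ 3 + a * b ^ 4

/-- The form `b⁵ + 3b⁴a + 4b³a² + 2b²a³ + ba⁴`. -/
def formB {R : Type*} [CommRing R] (a b : R) : R :=
  b ^ 5 + 3 * b ^ 4 * a + 4 * b ^ 3 * a ^ 2 + 2 * b ^ 2 * a ^ 3 + b * a ^ 4

/-- `α = (1 + √5) / 2`. -/
def α : ℝ := (1 + √5) / 2

/-- `β = (1 - √5) / 2`. -/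
def β : ℝ := (1 - √5) / 2

/-! ### Real `q` with `-1 < q < 1` -/

/-- The real fifth root of a real number (of either sign). -/
def fifthRoot (x : ℝ) : ℝ := Real.sign x * |x| ^ (1 / 5 : ℝ)

theorem fifthRoot_pow (x : ℝ) : fifthRoot x ^ 5 = x := by
  have h : (|x| ^ (1 / 5 : ℝ)) ^ 5 = |x| := by
    rw [← Real.rpow_natCast, ← Real.rpow_mul (abs_nonneg x)]
    norm_num
  rw [fifthRoot, mul_pow, h]
  rcases lt_trichotomy x 0 with hx | hx | hx
  · rw [Real.sign_of_neg hx, abs_of_neg hx]; ring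
  · subst hx; simp
  · rw [Real.sign_of_pos hx, abs_of_pos hx]; ring

/-- `A(q) = q^{1/5} (q;q)_∞^{-3/5} ∑ (-1)^n q^{(5n² - 3n)/2}` for real `q`, `|q| < 1`
(where `(q;q)_∞ > 0`). -/
def realA (q : ℝ) : ℝ := fifthRoot q * qProd q ^ (-(3 / 5) : ℝ) * seriesA q

/-- `B(q) = (q;q)_∞^{-3/5} ∑ (-1)^n q^{(5n² - n)/2}` for real `q`, `|q| < 1`. -/
def realB (q : ℝ) : ℝ := qProd q ^ (-(3 / 5) : ℝ) * seriesB q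

/-- The quantity `𝒜` with the real fifth root. -/
def calA (a b : ℝ) : ℝ := fifthRoot (formA a b)

/-- The quantity `ℬ` with the real fifth root. -/
def calB (a b : ℝ) : ℝ := fifthRoot (formB a b)

/-- The quantity `𝒞` with real fifth roots. -/
def calC (a b : ℝ) : ℝ :=
  (fifthRoot (b ^ 5 - α ^ 5 * a ^ 5) - fifthRoot (b ^ 5 - β ^ 5 * a ^ 5)) / (β - α)

/-- The quantity `𝒟` with real fifth roots. -/
def calD (a b : ℝ) : ℝ :=
  (β * fifthRoot (b ^ 5 - α ^ 5 * a ^ 5) - α * fifthRoot (b ^ 5 - β ^ 5 * a ^ 5)) / (β - α)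

/-! ### Complex `q = e^{2πiτ}` with `τ` in the upper half-plane -/

/-- `q = e^{2πiτ}`; in general `q^r` stands for `e^{2πirτ}`, that is `nome (r * τ)`. -/
def nome (τ : ℂ) : ℂ := Complex.exp (2 * Real.pi * Complex.I * τ)

/-- The power `(q;q)_∞^s` for `|q| < 1`: the branch that is holomorphic in the unit disc and takes
the value `1` at `q = 0`. -/
def qProdPow (s q : ℂ) : ℂ := Complex.exp (s * ∑' n : ℕ, Complex.log (1 - q ^ (n + 1)))

theorem summable_log (q : ℂ) (hq : ‖q‖ < 1) :
    Summable fun n : ℕ => Complex.log (1 - q ^ (n + 1)) := by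
  have h : Summable fun n : ℕ => -(q ^ (n + 1)) := by
    have h0 : Summable fun n : ℕ => q ^ n := summable_geometric_of_norm_lt_one hq
    exact ((summable_nat_add_iff (f := fun n : ℕ => q ^ n) 1).2 h0).neg
  exact (Complex.summable_log_one_add_of_summable h).congr fun n => by rw [sub_eq_add_neg]

theorem qProdPow_one (q : ℂ) (hq : ‖q‖ < 1) : qProdPow 1 q = qProd q := by
  have hne : ∀ n : ℕ, 1 - q ^ (n + 1) ≠ 0 := by
    intro n h
    have h1 : ‖q ^ (n + 1)‖ = 1 := by rw [← sub_eq_zero.1 h, norm_one]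
    rw [norm_pow] at h1
    exact (pow_lt_one₀ (norm_nonneg q) hq n.succ_ne_zero).ne h1
  rw [qProdPow, one_mul, qProd, Complex.cexp_tsum_eq_tprod hne (summable_log q hq)]

theorem qProdPow_add (s t q : ℂ) : qProdPow (s + t) q = qProdPow s q * qProdPow t q := by
  rw [qProdPow, qProdPow, qProdPow, add_mul, Complex.exp_add]

/-- `A(τ) = q^{1/5} (q;q)_∞^{-3/5} ∑ (-1)^n q^{(5n² - 3n)/2}` with `q = e^{2πiτ}`. -/
def thetaA (τ : ℂ) : ℂ :=
  nome (τ / 5) * qProdPow (-(3 / 5)) (nome τ) * seriesA (nome τ)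

/-- `B(τ) = (q;q)_∞^{-3/5} ∑ (-1)^n q^{(5n² - n)/2}` with `q = e^{2πiτ}`. -/
def thetaB (τ : ℂ) : ℂ := qProdPow (-(3 / 5)) (nome τ) * seriesB (nome τ)

/-- `F` is the branch on the upper half-plane of the fifth root of `f` with leading term `g`:
it is continuous, its fifth power is `f`, and `F / g → 1` as `q → 0`, that is, as
`Im τ → ∞`. For `g = 1` this is the branch with `f ^ (1/5) → 1` as `f → 1`. -/
structure IsFifthRootBranch (f g F : ℍ → ℂ) : Prop where
  continuous : Continuous F
  pow_eq : ∀ τ, F τ ^ 5 = f τ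
  tendsto : Tendsto (fun τ => F τ / g τ) atImInfty (𝓝 1)

/-- `F` is the fifth root `𝒜`; its radicand is asymptotic to `q^{1/5}`, and `F` to `q^{1/25}`. -/
def IsCalA (F : ℍ → ℂ) : Prop :=
  IsFifthRootBranch (fun τ => formA (thetaA τ) (thetaB τ)) (fun τ => nome (τ / 25)) F

/-- `F` is the fifth root `ℬ`. -/
def IsCalB (F : ℍ → ℂ) : Prop :=
  IsFifthRootBranch (fun τ => formB (thetaA τ) (thetaB τ)) (fun _ => 1) F

/-- `F` is the fifth root of `B⁵ - c⁵ A⁵`. -/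
def IsRootBA (c : ℝ) (F : ℍ → ℂ) : Prop :=
  IsFifthRootBranch (fun τ => thetaB τ ^ 5 - (c : ℂ) ^ 5 * thetaA τ ^ 5) (fun _ => 1) F

end QuinticTheta

end

/-! Write F, G for `seriesA`, `seriesB`, P(q) for (q;q)_∞, and a = qF(q⁵), b = G(q⁵). The core is a
quintic transformation between q and q⁵: qP(q⁵)³F(q)⁵ = P(q)³ `formA a b` and P(q⁵)³G(q)⁵ = P(q)³
`formB a b` (`quintic_seriesA`, `quintic_seriesB`). Multiplied by powers of P these say that A(q)⁵
and B(q)⁵ are the two forms in A(q⁵), B(q⁵).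

The product FG is known in two ways. The triple product gives F(q)G(q) = P(q)P(q⁵)
(`seriesA_mul_seriesB_eq_qProd`). Splitting the double series over the cosets of (2 + i)ℤ[i] gives
F(q)G(q) = b² - ab - a² (`seriesA_mul_seriesB`). Equating the two and multiplying over q ↦ wq, w⁵ =
1, yields the degree-ten relation `qProd_pow_eleven`.

Let (X, Y) and (X', Y') be the left and right sides of the transformation. These relations give XY =
X'Y' and Y² - 11XY - X² = Y'² - 11X'Y' - X'², hence (Y ± iX)² = (Y' ± iX')². Both sides are
holomorphic in the disc and the unsquared quantities equal 1 at q = 0, so the squares can be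
removed.

The passage to q⁵ inverts this: if c² = c + 1 then (b - ca)⁵ = `formB a b` - c⁵ `formA a b`, so the
fifth roots of B⁵ - c⁵A⁵ are B(q⁵) - cA(q⁵), and c = α, β give a linear system. Real fifth roots are
unique. In the upper half-plane the radicands have no zeros, so two branches differ by a constant
fifth root of unity, which the behaviour at i∞ forces to be 1. -/

noncomputable section

namespace QuinticTheta

/-! ### The Jacobi triple product -/

/-- The finite product `(q;q)_n = ∏_{1 ≤ k ≤ n} (1 - q ^ k)`. -/
def qFac (q : ℂ) (n : ℕ) : ℂ := ∏ k ∈ Finset.range n, (1 - q ^ (k + 1))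

/-- The reciprocal of `(q;q)_k`, extended by zero to negative `k`. -/
def qFacInv (q : ℂ) (k : ℤ) : ℂ := if k < 0 then 0 else (qFac q k.toNat)⁻¹

theorem one_sub_pow_ne_zero {q : ℂ} (hq : ‖q‖ < 1) (n : ℕ) : 1 - q ^ (n + 1) ≠ 0 := by
  intro h
  have h1 : ‖q ^ (n + 1)‖ = 1 := by rw [← sub_eq_zero.1 h, norm_one]
  rw [norm_pow] at h1
  exact (pow_lt_one₀ (norm_nonneg q) hq n.succ_ne_zero).ne h1

theorem qProd_ne_zero {q : ℂ} (hq : ‖q‖ < 1) : qProd q ≠ 0 := by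
  rw [← qProdPow_one q hq]
  exact Complex.exp_ne_zero _

theorem multipliable_one_sub_pow {𝕜 : Type*} [NormedField 𝕜] [CompleteSpace 𝕜] {q : 𝕜}
    (hq : ‖q‖ < 1) : Multipliable fun n : ℕ => 1 - q ^ (n + 1) := by
  have h0 : Summable fun n : ℕ => ‖-q ^ (n + 1)‖ := by
    simp only [norm_neg, norm_pow]
    exact (summable_nat_add_iff (f := fun n : ℕ => ‖q‖ ^ n) 1).2
      (summable_geometric_of_lt_one (norm_nonneg q) hq)
  simpa only [sub_eq_add_neg] using multipliable_one_add_of_summable h0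

theorem tendsto_qFac {q : ℂ} (hq : ‖q‖ < 1) : Tendsto (qFac q) atTop (𝓝 (qProd q)) :=
  (multipliable_one_sub_pow hq).hasProd.tendsto_prod_nat

/-- At k = 0 the factor 1 - q⁰ vanishes, in agreement with the extension by zero. The recurrence
therefore holds for all integers, and the finite triple product needs no boundary cases. -/
theorem qFacInv_sub_one {q : ℂ} (hq : ‖q‖ < 1) (k : ℤ) :
    qFacInv q (k - 1) = (1 - q ^ k) * qFacInv q k := by
  rcases lt_trichotomy k 0 with hk | rfl | hk
  · simp [qFacInv, hk, show k - 1 < 0 by omega]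
  · simp [qFacInv]
  · obtain ⟨n, rfl⟩ : ∃ n : ℕ, k = n + 1 := ⟨(k - 1).toNat, by omega⟩
    have h1 : ¬ ((n : ℤ) + 1 < 0) := by omega
    have h2 : ¬ ((n : ℤ) < 0) := by omega
    have h3 : ((n : ℤ) + 1).toNat = n + 1 := by omega
    rw [add_sub_cancel_right, qFacInv, qFacInv, if_neg h1, if_neg h2, h3, Int.toNat_natCast,
      qFac, qFac, Finset.prod_range_succ]
    have h4 := one_sub_pow_ne_zero hq n
    have h5 : q ^ ((n : ℤ) + 1) = q ^ (n + 1) := by exact_mod_cast zpow_natCast q (n + 1)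
    rw [h5, mul_inv, mul_left_comm, mul_inv_cancel₀ h4, mul_one]

theorem exists_norm_qFac_le {q : ℂ} (hq : ‖q‖ < 1) : ∃ C, ∀ n, ‖qFac q n‖ ≤ C := by
  obtain ⟨C, hC⟩ := (Metric.isBounded_range_of_tendsto _ (tendsto_qFac hq)).exists_norm_le
  exact ⟨C, fun n => hC _ ⟨n, rfl⟩⟩

theorem exists_norm_qFacInv_le {q : ℂ} (hq : ‖q‖ < 1) :
    ∃ C, ∀ k, ‖qFacInv q k‖ ≤ C := by
  obtain ⟨C, hC⟩ := (Metric.isBounded_range_of_tendsto _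
    ((tendsto_qFac hq).inv₀ (qProd_ne_zero hq))).exists_norm_le
  refine ⟨C, fun k => ?_⟩
  rw [qFacInv]
  split_ifs
  · rw [norm_zero]
    exact (norm_nonneg _).trans (hC _ ⟨0, rfl⟩)
  · exact hC _ ⟨k.toNat, rfl⟩

theorem tendsto_qFacInv {q : ℂ} (hq : ‖q‖ < 1) :
    Tendsto (qFacInv q) atTop (𝓝 (qProd q)⁻¹) := by
  have h : Tendsto (fun k : ℤ => (qFac q k.toNat)⁻¹) atTop (𝓝 (qProd q)⁻¹) :=
    ((tendsto_qFac hq).inv₀ (qProd_ne_zero hq)).comp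
      (tendsto_atTop_atTop.2 fun b => ⟨b, fun k hk => by omega⟩)
  refine h.congr' ?_
  filter_upwards [eventually_ge_atTop (0 : ℤ)] with k hk
  rw [qFacInv, if_neg (not_lt.2 hk)]

/-- The finite form of the Jacobi triple product, with coefficients `t` satisfying the recurrence
of `(-1)^j z^j q^{j(j-1)/2}`. -/
theorem hasSum_finite_triple_product {q z : ℂ} (hq : ‖q‖ < 1) (hq0 : q ≠ 0) (hz : z ≠ 0)
    {t : ℤ → ℂ} (ht0 : t 0 = 1) (ht : ∀ j, t (j + 1) = -z * q ^ j * t j) (n : ℕ) :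
    HasSum (fun j : ℤ => qFac q (2 * n) * qFacInv q (n + j) * qFacInv q (n - j) * t j)
      (∏ k ∈ Finset.range n, (1 - z * q ^ k) * (1 - z⁻¹ * q ^ (k + 1))) := by
  induction n with
  | zero =>
    have h := hasSum_single (f := fun j : ℤ => qFac q (2 * 0) * qFacInv q ((0 : ℕ) + j) *
      qFacInv q ((0 : ℕ) - j) * t j) 0 (fun j hj => by
        rcases lt_or_gt_of_ne hj with hj | hj
        · simp [qFacInv, hj]
        · simp [qFacInv, hj])
    simpa [qFacInv, qFac, ht0] using h
  | succ n ih =>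
    -- The new factor expands as (1 + q^{2n+1}) - zqⁿ - z⁻¹q^{n+1}. The terms in z and z⁻¹ shift the
    -- index j by one.
    have h1 := ih.mul_left (1 + q ^ (2 * n + 1))
    have h2 := ((Equiv.subRight (1 : ℤ)).hasSum_iff.2 ih).mul_left (-z * q ^ n)
    have h3 := ((Equiv.addRight (1 : ℤ)).hasSum_iff.2 ih).mul_left (-z⁻¹ * q ^ (n + 1))
    have h := (h1.add h2).add h3
    have hv : ∀ Q : ℂ, Q * ((1 - z * q ^ n) * (1 - z⁻¹ * q ^ (n + 1))) =
        (1 + q ^ (2 * n + 1)) * Q + -z * q ^ n * Q + -z⁻¹ * q ^ (n + 1) * Q := fun Q => by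
      linear_combination Q * q ^ n * q ^ (n + 1) * mul_inv_cancel₀ hz
    rw [Finset.prod_range_succ, hv]
    refine Eq.subst (motive := fun f => HasSum f _) (funext fun j => Eq.symm ?_) h
    simp only [Function.comp_apply, Equiv.subRight_apply, Equiv.coe_addRight]
    set a := qFacInv q (n + 1 + j) with ha
    set b := qFacInv q (n + 1 - j) with hb
    have e1 : qFacInv q (n + j) = (1 - q ^ ((n : ℤ) + 1 + j)) * a := by
      rw [ha, ← qFacInv_sub_one hq]; congr 1; ring
    have e2 : qFacInv q (n - j) = (1 - q ^ ((n : ℤ) + 1 - j)) * b := by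
      rw [hb, ← qFacInv_sub_one hq]; congr 1; ring
    have e3 : qFacInv q (n + (j - 1)) = (1 - q ^ ((n : ℤ) + j)) * qFacInv q (n + j) := by
      rw [← qFacInv_sub_one hq]; congr 1; ring
    have e4 : qFacInv q (n - (j + 1)) = (1 - q ^ ((n : ℤ) - j)) * qFacInv q (n - j) := by
      rw [← qFacInv_sub_one hq]; congr 1; ring
    have e5 : qFacInv q (n - (j - 1)) = b := by rw [hb]; congr 1; ring
    have e6 : qFacInv q (n + (j + 1)) = a := by rw [ha]; congr 1; ring
    have e7 : qFacInv q ((n + 1 : ℕ) + j) = a := by rw [ha]; congr 1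
    have e8 : qFacInv q ((n + 1 : ℕ) - j) = b := by rw [hb]; congr 1
    have e9 : qFac q (2 * (n + 1)) =
        qFac q (2 * n) * (1 - q ^ (2 * n + 1)) * (1 - q ^ (2 * n + 2)) := by
      rw [qFac, qFac, show 2 * (n + 1) = 2 * n + 1 + 1 by ring, Finset.prod_range_succ,
        Finset.prod_range_succ]
    have t1 : t j = -z * q ^ (j - 1) * t (j - 1) := by
      rw [← ht, sub_add_cancel]
    have t2 : -z * q ^ n * t (j - 1) = q ^ n * (q ^ (j - 1))⁻¹ * t j := by
      rw [t1]
      field_simp [zpow_ne_zero (j - 1) hq0]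
    have t3 : -z⁻¹ * q ^ (n + 1) * t (j + 1) = q ^ (n + 1) * q ^ j * t j := by
      rw [ht]
      field_simp
    have z1 : q ^ ((n : ℤ) + 1 + j) = q * q ^ n * q ^ j := by
      rw [zpow_add₀ hq0, zpow_add₀ hq0, zpow_natCast, zpow_one]; ring
    have z2 : q ^ ((n : ℤ) + 1 - j) = q * q ^ n * (q ^ j)⁻¹ := by
      rw [zpow_sub₀ hq0, zpow_add₀ hq0, zpow_natCast, zpow_one]; ring
    have z3 : q ^ ((n : ℤ) + j) = q ^ n * q ^ j := by
      rw [zpow_add₀ hq0, zpow_natCast]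
    have z4 : q ^ ((n : ℤ) - j) = q ^ n * (q ^ j)⁻¹ := by
      rw [zpow_sub₀ hq0, zpow_natCast]; ring
    have z5 : (q ^ (j - 1))⁻¹ = q * (q ^ j)⁻¹ := by
      rw [zpow_sub_one₀ hq0, mul_inv, inv_inv]; ring
    have hw : q ^ j * (q ^ j)⁻¹ = 1 := mul_inv_cancel₀ (zpow_ne_zero j hq0)
    rw [e3, e4, e5, e6, e7, e8, e9, e1, e2]
    have L2 : -z * q ^ n * (qFac q (2 * n) * ((1 - q ^ ((n : ℤ) + j)) *
        ((1 - q ^ ((n : ℤ) + 1 + j)) * a)) * b * t (j - 1)) =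
        (qFac q (2 * n) * ((1 - q ^ ((n : ℤ) + j)) *
        ((1 - q ^ ((n : ℤ) + 1 + j)) * a)) * b) * (-z * q ^ n * t (j - 1)) := by ring
    have L3 : -z⁻¹ * q ^ (n + 1) * (qFac q (2 * n) * a * ((1 - q ^ ((n : ℤ) - j)) *
        ((1 - q ^ ((n : ℤ) + 1 - j)) * b)) * t (j + 1)) =
        (qFac q (2 * n) * a * ((1 - q ^ ((n : ℤ) - j)) *
        ((1 - q ^ ((n : ℤ) + 1 - j)) * b))) * (-z⁻¹ * q ^ (n + 1) * t (j + 1)) := by ring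
    rw [L2, L3, t2, t3, z1, z2, z3, z4, z5]
    generalize (q ^ j)⁻¹ = w at hw ⊢
    generalize q ^ j = y at hw ⊢
    have p1 : q ^ (2 * n + 1) = q * q ^ n * q ^ n := by ring
    have p2 : q ^ (2 * n + 2) = q ^ 2 * q ^ n * q ^ n := by ring
    have p3 : q ^ (n + 1) = q * q ^ n := by ring
    rw [p1, p2, p3]
    generalize q ^ n = x
    generalize qFac q (2 * n) = c
    generalize t j = s
    -- With x = qⁿ, y = q^j, w = q^{-j} this is the recurrence of the Gaussian binomials from 2n to
    -- 2n + 2, a polynomial identity modulo yw = 1.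
    have hd : (1 - q * x * x) * (1 - q ^ 2 * x * x) =
        (1 + q * x * x) * (1 - q * x * y) * (1 - q * x * w) +
        q * x * w * (1 - x * y) * (1 - q * x * y) +
        q * x * y * (1 - x * w) * (1 - q * x * w) := by
      linear_combination (-((1 + q * x ^ 2) * q ^ 2 * x ^ 2 - 2 * q * (1 + q) * x ^ 2 +
        q ^ 2 * x ^ 3 * (y + w))) * hw
    linear_combination c * a * b * s * hd

/-- The Jacobi triple product. -/
theorem tendsto_triple_product {q z : ℂ} (hq : ‖q‖ < 1) (hq0 : q ≠ 0) (hz : z ≠ 0)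
    {t : ℤ → ℂ} (ht0 : t 0 = 1) (ht : ∀ j, t (j + 1) = -z * q ^ j * t j)
    (hs : Summable fun j => ‖t j‖) :
    Tendsto (fun n : ℕ => ∏ k ∈ Finset.range n, (1 - z * q ^ k) * (1 - z⁻¹ * q ^ (k + 1)))
      atTop (𝓝 ((qProd q)⁻¹ * ∑' j, t j)) := by
  obtain ⟨C, hC⟩ := exists_norm_qFac_le hq
  obtain ⟨D, hD⟩ := exists_norm_qFacInv_le hq
  have hC0 : 0 ≤ C := (norm_nonneg _).trans (hC 0)
  have hD0 : 0 ≤ D := (norm_nonneg _).trans (hD 0)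
  have hP := qProd_ne_zero hq
  have h := tendsto_tsum_of_dominated_convergence (𝓕 := (atTop : Filter ℕ))
    (f := fun (n : ℕ) (j : ℤ) =>
      qFac q (2 * n) * qFacInv q (n + j) * qFacInv q (n - j) * t j)
    (g := fun j => (qProd q)⁻¹ * t j) (bound := fun j => C * D * D * ‖t j‖)
    (hs.mul_left _) (fun j => ?_) (Eventually.of_forall fun n j => ?_)
  · rw [tsum_mul_left] at h
    refine h.congr fun n => ?_
    exact (hasSum_finite_triple_product hq hq0 hz ht0 ht n).tsum_eq
  · have h1 : Tendsto (fun n : ℕ => qFac q (2 * n)) atTop (𝓝 (qProd q)) :=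
      (tendsto_qFac hq).comp (tendsto_atTop_atTop.2 fun b => ⟨b, fun n hn => by omega⟩)
    have h2 : Tendsto (fun n : ℕ => qFacInv q (n + j)) atTop (𝓝 (qProd q)⁻¹) :=
      (tendsto_qFacInv hq).comp
        (tendsto_atTop_atTop.2 fun b => ⟨(b - j).toNat, fun n hn => by omega⟩)
    have h3 : Tendsto (fun n : ℕ => qFacInv q (n - j)) atTop (𝓝 (qProd q)⁻¹) :=
      (tendsto_qFacInv hq).comp
        (tendsto_atTop_atTop.2 fun b => ⟨(b + j).toNat, fun n hn => by omega⟩)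
    have h4 := ((h1.mul h2).mul h3).mul_const (t j)
    rwa [mul_inv_cancel₀ hP, one_mul] at h4
  · rw [norm_mul, norm_mul, norm_mul]
    gcongr
    · exact hC _
    · exact hD _
    · exact hD _

/-! ### The two theta series and their five-dissection -/

theorem two_mul_expA (n : ℤ) : 2 * ((5 * n ^ 2 - 3 * n) / 2) = 5 * n ^ 2 - 3 * n := by
  refine Int.mul_ediv_cancel' ?_
  rcases Int.even_or_odd' n with ⟨k, rfl | rfl⟩
  · exact ⟨10 * k ^ 2 - 3 * k, by ring⟩
  · exact ⟨10 * k ^ 2 + 7 * k + 1, by ring⟩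

theorem two_mul_expB (n : ℤ) : 2 * ((5 * n ^ 2 - n) / 2) = 5 * n ^ 2 - n := by
  refine Int.mul_ediv_cancel' ?_
  rcases Int.even_or_odd' n with ⟨k, rfl | rfl⟩
  · exact ⟨10 * k ^ 2 - k, by ring⟩
  · exact ⟨10 * k ^ 2 + 9 * k + 2, by ring⟩

/-- A linear lower bound for the exponent provides the geometric majorant behind both absolute
convergence and holomorphy of the series. -/
theorem natAbs_le_expA (n : ℤ) : (n.natAbs : ℤ) ≤ (5 * n ^ 2 - 3 * n) / 2 := by
  have := two_mul_expA n
  have := Int.natAbs_le_self_sq n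
  have := Int.le_self_sq n
  linarith

theorem natAbs_le_expB (n : ℤ) : (n.natAbs : ℤ) ≤ (5 * n ^ 2 - n) / 2 := by
  have := two_mul_expB n
  have := Int.natAbs_le_self_sq n
  have := Int.le_self_sq n
  linarith [sq_nonneg n]

/-- The general term of `seriesA`. -/
def termA (q : ℂ) (n : ℤ) : ℂ := (-1) ^ n * q ^ ((5 * n ^ 2 - 3 * n) / 2)

/-- The general term of `seriesB`. -/
def termB (q : ℂ) (n : ℤ) : ℂ := (-1) ^ n * q ^ ((5 * n ^ 2 - n) / 2)

theorem seriesA_eq (q : ℂ) : seriesA q = ∑' n, termA q n := rfl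

theorem seriesB_eq (q : ℂ) : seriesB q = ∑' n, termB q n := rfl

theorem norm_sign_mul_zpow_le {q : ℂ} {r : ℝ} (hqr : ‖q‖ ≤ r) (hr : r < 1) (n e : ℤ)
    (h : (n.natAbs : ℤ) ≤ e) : ‖(-1) ^ n * q ^ e‖ ≤ r ^ n.natAbs := by
  obtain ⟨k, rfl⟩ : ∃ k : ℕ, e = k := ⟨e.toNat, by omega⟩
  rw [norm_mul, norm_zpow, norm_neg, norm_one, one_zpow, one_mul, zpow_natCast, norm_pow]
  exact (pow_le_pow_left₀ (norm_nonneg q) hqr k).trans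
    (pow_le_pow_of_le_one ((norm_nonneg q).trans hqr) hr.le (by omega))

theorem norm_termA_le {q : ℂ} {r : ℝ} (hqr : ‖q‖ ≤ r) (hr : r < 1) (n : ℤ) :
    ‖termA q n‖ ≤ r ^ n.natAbs :=
  norm_sign_mul_zpow_le hqr hr n _ (natAbs_le_expA n)

theorem norm_termB_le {q : ℂ} {r : ℝ} (hqr : ‖q‖ ≤ r) (hr : r < 1) (n : ℤ) :
    ‖termB q n‖ ≤ r ^ n.natAbs :=
  norm_sign_mul_zpow_le hqr hr n _ (natAbs_le_expB n)

theorem summable_pow_natAbs {r : ℝ} (hr0 : 0 ≤ r) (hr : r < 1) :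
    Summable fun n : ℤ => r ^ n.natAbs := by
  refine Summable.of_nat_of_neg ?_ ?_ <;>
  simpa using summable_geometric_of_lt_one hr0 hr

theorem summable_norm_termA {q : ℂ} (hq : ‖q‖ < 1) : Summable fun n => ‖termA q n‖ :=
  (summable_pow_natAbs (norm_nonneg q) hq).of_nonneg_of_le (fun _ => norm_nonneg _)
    (norm_termA_le le_rfl hq)

theorem summable_norm_termB {q : ℂ} (hq : ‖q‖ < 1) : Summable fun n => ‖termB q n‖ :=
  (summable_pow_natAbs (norm_nonneg q) hq).of_nonneg_of_le (fun _ => norm_nonneg _)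
    (norm_termB_le le_rfl hq)

theorem seriesA_zero : seriesA (0 : ℂ) = 1 := by
  rw [seriesA_eq, tsum_eq_single 0 fun n hn => ?_]
  · simp [termA]
  · rw [termA, zero_zpow, mul_zero]
    have := natAbs_le_expA n
    omega

theorem seriesB_zero : seriesB (0 : ℂ) = 1 := by
  rw [seriesB_eq, tsum_eq_single 0 fun n hn => ?_]
  · simp [termB]
  · rw [termB, zero_zpow, mul_zero]
    have := natAbs_le_expB n
    omega

theorem qProd_zero : qProd (0 : ℂ) = 1 := by
  simp [qProd]

/-- The decomposition of `ℤ²` into the five cosets of the sublattice `(2 + i) ℤ[i]`. -/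
def cosetEquiv : Fin 5 × ℤ × ℤ ≃ ℤ × ℤ where
  toFun x := (2 * x.2.1 + x.2.2 + (x.1 : ℕ), 2 * x.2.2 - x.2.1)
  invFun p := (⟨((p.1 + 2 * p.2) % 5).toNat, by omega⟩,
    2 * ((p.1 + 2 * p.2) / 5) - p.2, (p.1 + 2 * p.2) / 5)
  left_inv := by
    rintro ⟨⟨c, hc⟩, a, b⟩
    simp only [Prod.mk.injEq, Fin.mk.injEq]
    omega
  right_inv := by
    rintro ⟨m, n⟩
    simp only [Prod.mk.injEq]
    omega

theorem termA_mul_termB {q : ℂ} (hq : q ≠ 0) (m n e s : ℤ) (h : 2 * e = 5 * m ^ 2 - 3 * m +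
    (5 * n ^ 2 - n)) (hs : Even (m + n - s)) :
    termA q m * termB q n = (-1) ^ s * q ^ e := by
  have h1 : (-1 : ℂ) ^ m * (-1) ^ n = (-1) ^ s := by
    rw [← zpow_add₀ (by norm_num), show m + n = (m + n - s) + s by ring,
      zpow_add₀ (by norm_num), hs.neg_one_zpow, one_mul]
  have h2 : e = (5 * m ^ 2 - 3 * m) / 2 + (5 * n ^ 2 - n) / 2 := by
    linarith [two_mul_expA m, two_mul_expB n]
  rw [termA, termB, h2, zpow_add₀ hq, ← h1]
  ring

theorem termA_pow_five (q : ℂ) (n : ℤ) :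
    termA (q ^ 5) n = (-1) ^ n * q ^ (5 * ((5 * n ^ 2 - 3 * n) / 2)) := by
  rw [termA, zpow_mul]; norm_cast

theorem termB_pow_five (q : ℂ) (n : ℤ) :
    termB (q ^ 5) n = (-1) ^ n * q ^ (5 * ((5 * n ^ 2 - n) / 2)) := by
  rw [termB, zpow_mul]; norm_cast

theorem tsum_eq_zero_of_equiv_neg {ι : Type*} {f : ι → ℂ} (e : ι ≃ ι)
    (h : ∀ x, f (e x) = -f x) : ∑' x, f x = 0 := by
  have h1 := e.tsum_eq f
  simp only [h, tsum_neg] at h1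
  linear_combination (-1 / 2) * h1

theorem norm_pow_five_lt_one {q : ℂ} (hq : ‖q‖ < 1) : ‖q ^ 5‖ < 1 := by
  rw [norm_pow]
  exact pow_lt_one₀ (norm_nonneg q) hq (by norm_num)

/-- The general term of `seriesA q * seriesB q` on a coset of `(2 + i) ℤ[i]`. -/
def cosetTerm (q : ℂ) (c : ℕ) (p : ℤ × ℤ) : ℂ :=
  termA q (2 * p.1 + p.2 + c) * termB q (2 * p.2 - p.1)

/-- Under m = 2a + b + c, n = 2b - a the cross term in ab cancels, so on each coset the exponent is
a function of a plus a function of b. The exponent enters through its double and the sign through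
its parity, which avoids integer division. -/
theorem cosetTerm_eq {q : ℂ} (hq : q ≠ 0) (c : ℕ) (a b e s : ℤ)
    (h : 2 * e = 25 * (a ^ 2 + b ^ 2) + 20 * (a * c) + 10 * (b * c) + 5 * c ^ 2 - 5 * a - 5 * b
      - 3 * c) (hs : Even (a + b + c - s)) :
    cosetTerm q c (a, b) = (-1) ^ s * q ^ e := by
  refine termA_mul_termB hq _ _ _ _ (by rw [h]; ring) ?_
  obtain ⟨k, hk⟩ := hs
  exact ⟨k + b, by linarith⟩

theorem tsum_cosetTerm_zero {q : ℂ} (hq : ‖q‖ < 1) (hq0 : q ≠ 0) :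
    ∑' p, cosetTerm q 0 p = seriesB (q ^ 5) ^ 2 := by
  have hB5 := summable_norm_termB (norm_pow_five_lt_one hq)
  rw [sq, seriesB_eq, tsum_mul_tsum_of_summable_norm hB5 hB5]
  refine tsum_congr fun ⟨a, b⟩ => ?_
  rw [cosetTerm_eq hq0 _ _ _ (5 * ((5 * a ^ 2 - a) / 2) + 5 * ((5 * b ^ 2 - b) / 2)) (a + b)
    (by push_cast; linarith [two_mul_expB a, two_mul_expB b]) (by simp),
    termB_pow_five, termB_pow_five, zpow_add₀ (by norm_num), zpow_add₀ hq0]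
  ring

/-- Here twice the exponent is (25a² + 15a) + (25b² + 5b) + 2, which has the shape of the two theta
exponents after reflecting both indices. -/
theorem tsum_cosetTerm_one {q : ℂ} (hq : ‖q‖ < 1) (hq0 : q ≠ 0) :
    ∑' p, cosetTerm q 1 p = -(q * seriesA (q ^ 5) * seriesB (q ^ 5)) := by
  have hA5 : Summable fun n => ‖termA (q ^ 5) (-n)‖ :=
    (summable_norm_termA (norm_pow_five_lt_one hq)).comp_injective neg_injective
  have hB5 : Summable fun n => ‖termB (q ^ 5) (-n)‖ :=
    (summable_norm_termB (norm_pow_five_lt_one hq)).comp_injective neg_injective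
  have tA : ∑' n, termA (q ^ 5) (-n) = seriesA (q ^ 5) :=
    (Equiv.neg ℤ).tsum_eq (termA (q ^ 5))
  have tB : ∑' n, termB (q ^ 5) (-n) = seriesB (q ^ 5) :=
    (Equiv.neg ℤ).tsum_eq (termB (q ^ 5))
  rw [mul_assoc, ← tA, ← tB, tsum_mul_tsum_of_summable_norm hA5 hB5, ← tsum_mul_left,
    ← tsum_neg]
  refine tsum_congr fun ⟨a, b⟩ => ?_
  rw [cosetTerm_eq hq0 _ _ _ (1 + 5 * ((5 * (-a) ^ 2 - 3 * (-a)) / 2) +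
    5 * ((5 * (-b) ^ 2 - (-b)) / 2)) (1 + (-a) + (-b))
    (by push_cast; linarith [two_mul_expA (-a), two_mul_expB (-b)])
    ⟨a + b, by push_cast; ring⟩, termA_pow_five, termB_pow_five, zpow_add₀ (by norm_num),
    zpow_add₀ (by norm_num), zpow_add₀ hq0, zpow_add₀ hq0, zpow_one, zpow_one]
  ring

/-- Twice the exponent is (25a² + 35a) + (25b² + 15b) + 14. The shift a + 1 and the reflection -b
bring both parts to the exponent of `seriesA`, leaving the constant 4. -/
theorem tsum_cosetTerm_two {q : ℂ} (hq : ‖q‖ < 1) (hq0 : q ≠ 0) :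
    ∑' p, cosetTerm q 2 p = -(q ^ 2 * (seriesA (q ^ 5) * seriesA (q ^ 5))) := by
  have hA5 : Summable fun n => ‖termA (q ^ 5) (-n)‖ :=
    (summable_norm_termA (norm_pow_five_lt_one hq)).comp_injective neg_injective
  have hA5' : Summable fun n => ‖termA (q ^ 5) (n + 1)‖ :=
    (summable_norm_termA (norm_pow_five_lt_one hq)).comp_injective (add_left_injective 1)
  have tA : ∑' n, termA (q ^ 5) (-n) = seriesA (q ^ 5) :=
    (Equiv.neg ℤ).tsum_eq (termA (q ^ 5))
  have tA' : ∑' n, termA (q ^ 5) (n + 1) = seriesA (q ^ 5) :=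
    (Equiv.addRight (1 : ℤ)).tsum_eq (termA (q ^ 5))
  nth_rewrite 1 [← tA']
  rw [← tA, tsum_mul_tsum_of_summable_norm hA5' hA5, ← tsum_mul_left, ← tsum_neg]
  refine tsum_congr fun ⟨a, b⟩ => ?_
  rw [cosetTerm_eq hq0 _ _ _ (2 + 5 * ((5 * (a + 1) ^ 2 - 3 * (a + 1)) / 2) +
    5 * ((5 * (-b) ^ 2 - 3 * (-b)) / 2)) (1 + (a + 1) + (-b))
    (by push_cast; linarith [two_mul_expA (a + 1), two_mul_expA (-b)])
    ⟨b, by push_cast; ring⟩, termA_pow_five, termA_pow_five, zpow_add₀ (by norm_num),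
    zpow_add₀ (by norm_num), zpow_add₀ hq0, zpow_add₀ hq0, zpow_one, zpow_ofNat]
  ring

theorem cosetTerm_neg {q : ℂ} (hq : q ≠ 0) (c : ℕ) (a b a' b' : ℤ)
    (h : 25 * (a' ^ 2 + b' ^ 2) + 20 * (a' * c) + 10 * (b' * c) - 5 * a' - 5 * b' =
      25 * (a ^ 2 + b ^ 2) + 20 * (a * c) + 10 * (b * c) - 5 * a - 5 * b)
    (hs : Odd (a' + b' - a - b)) : cosetTerm q c (a', b') = -cosetTerm q c (a, b) := by
  have h1 := two_mul_expA (2 * a + b + c)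
  have h2 := two_mul_expB (2 * b - a)
  rw [cosetTerm_eq hq c a b ((5 * (2 * a + b + c) ^ 2 - 3 * (2 * a + b + c)) / 2 +
    (5 * (2 * b - a) ^ 2 - (2 * b - a)) / 2) (a + b + c) (by linarith) (by simp),
    cosetTerm_eq hq c a' b' ((5 * (2 * a + b + c) ^ 2 - 3 * (2 * a + b + c)) / 2 +
    (5 * (2 * b - a) ^ 2 - (2 * b - a)) / 2) (1 + (a + b + c)) (by linarith) ?_,
    zpow_add₀ (by norm_num), zpow_one, neg_one_mul, neg_mul]
  obtain ⟨k, hk⟩ := hs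
  exact ⟨k, by linarith⟩

/-- Twice the exponent depends on b through 25b(b + 1), which b ↦ -1 - b preserves while reversing
the sign of the term. -/
theorem tsum_cosetTerm_three {q : ℂ} (hq0 : q ≠ 0) : ∑' p, cosetTerm q 3 p = 0 :=
  tsum_eq_zero_of_equiv_neg ((Equiv.refl ℤ).prodCongr (Equiv.subLeft (-1))) fun ⟨a, b⟩ =>
    cosetTerm_neg hq0 3 a b a (-1 - b) (by push_cast; ring) ⟨-b - 1, by ring⟩

/-- The dependence on a is now through 25a(a + 3), and a ↦ -3 - a reverses the sign. -/
theorem tsum_cosetTerm_four {q : ℂ} (hq0 : q ≠ 0) : ∑' p, cosetTerm q 4 p = 0 :=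
  tsum_eq_zero_of_equiv_neg ((Equiv.subLeft (-3)).prodCongr (Equiv.refl ℤ)) fun ⟨a, b⟩ =>
    cosetTerm_neg hq0 4 a b (-3 - a) b (by push_cast; ring) ⟨-a - 2, by ring⟩

theorem seriesA_mul_seriesB_eq_sum {q : ℂ} (hq : ‖q‖ < 1) :
    seriesA q * seriesB q = ∑ c : Fin 5, ∑' p, cosetTerm q c p := by
  have hA := summable_norm_termA hq
  have hB := summable_norm_termB hq
  have hsum : Summable fun x : Fin 5 × ℤ × ℤ => cosetTerm q x.1 x.2 :=
    cosetEquiv.summable_iff.2 (summable_mul_of_summable_norm hA hB)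
  rw [seriesA_eq, seriesB_eq, tsum_mul_tsum_of_summable_norm hA hB,
    ← cosetEquiv.tsum_eq, ← tsum_fintype (L := .unconditional _)]
  exact hsum.tsum_prod

/-- The five-dissection of the product of the two theta series. -/
theorem seriesA_mul_seriesB {q : ℂ} (hq : ‖q‖ < 1) :
    seriesA q * seriesB q = seriesB (q ^ 5) ^ 2 - q * seriesA (q ^ 5) * seriesB (q ^ 5) -
      q ^ 2 * seriesA (q ^ 5) ^ 2 := by
  rcases eq_or_ne q 0 with rfl | hq0
  · simp [seriesA_zero, seriesB_zero]
  rw [seriesA_mul_seriesB_eq_sum hq, Fin.sum_univ_five]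
  have h0 := tsum_cosetTerm_zero hq hq0
  have h1 := tsum_cosetTerm_one hq hq0
  have h2 := tsum_cosetTerm_two hq hq0
  have h3 := tsum_cosetTerm_three hq0
  have h4 := tsum_cosetTerm_four hq0
  calc _ = ∑' p, cosetTerm q 0 p + ∑' p, cosetTerm q 1 p + ∑' p, cosetTerm q 2 p +
        ∑' p, cosetTerm q 3 p + ∑' p, cosetTerm q 4 p := rfl
    _ = _ := by rw [h0, h1, h2, h3, h4]; ring

/-! ### Product formulas -/

theorem tendsto_qFac_mul {q : ℂ} (hq : ‖q‖ < 1) {k : ℕ} (hk : 0 < k) :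
    Tendsto (fun n => qFac q (k * n)) atTop (𝓝 (qProd q)) :=
  (tendsto_qFac hq).comp (tendsto_id.const_mul_atTop' hk)

/-- The factors of `(q;q)_{5n+4} / (q;q)_{5n}`. -/
def qBlock (q : ℂ) (n : ℕ) : ℂ := ∏ r ∈ Finset.range 4, (1 - q ^ (5 * n + (r + 1)))

theorem qFac_five_mul_succ (q : ℂ) (n : ℕ) :
    qFac q (5 * (n + 1)) = qFac q (5 * n) * qBlock q n * (1 - q ^ (5 * n + 5)) := by
  simp only [qFac, qBlock, show 5 * (n + 1) = 5 * n + 1 + 1 + 1 + 1 + 1 by ring,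
    Finset.prod_range_succ, Finset.prod_range_zero]
  ring

theorem qFac_succ (q : ℂ) (n : ℕ) : qFac q (n + 1) = qFac q n * (1 - q ^ (n + 1)) := by
  rw [qFac, qFac, Finset.prod_range_succ]

/-- In base q⁵ the triple products at z = q and z = q² supply the exponents congruent to ±1 and ±2
modulo 5, and the last factor supplies the multiples of 5. -/
theorem triple_products_mul_qFac {q : ℂ} (hq : q ≠ 0) (n : ℕ) :
    (∏ k ∈ Finset.range n, (1 - q * (q ^ 5) ^ k) * (1 - q⁻¹ * (q ^ 5) ^ (k + 1))) *
      (∏ k ∈ Finset.range n, (1 - q ^ 2 * (q ^ 5) ^ k) * (1 - (q ^ 2)⁻¹ * (q ^ 5) ^ (k + 1))) *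
      qFac (q ^ 5) n = qFac q (5 * n) := by
  induction n with
  | zero => simp [qFac]
  | succ n ih =>
    rw [qFac_five_mul_succ, ← ih, Finset.prod_range_succ, Finset.prod_range_succ, qFac_succ]
    have e1 : q⁻¹ * (q ^ 5) ^ (n + 1) = q ^ (5 * n + 4) := by
      rw [inv_mul_eq_iff_eq_mul₀ hq]; ring
    have e2 : (q ^ 2)⁻¹ * (q ^ 5) ^ (n + 1) = q ^ (5 * n + 3) := by
      rw [inv_mul_eq_iff_eq_mul₀ (pow_ne_zero 2 hq)]; ring
    have e3 : q * (q ^ 5) ^ n = q ^ (5 * n + 1) := by ring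
    have e4 : q ^ 2 * (q ^ 5) ^ n = q ^ (5 * n + 2) := by ring
    have e5 : (q ^ 5) ^ (n + 1) = q ^ (5 * n + 5) := by ring
    rw [e1, e2, e3, e4, e5]
    simp only [qBlock, Finset.prod_range_succ, Finset.prod_range_zero]
    ring

theorem termA_succ {q : ℂ} (hq : q ≠ 0) (j : ℤ) :
    termA q (j + 1) = -q * (q ^ 5) ^ j * termA q j := by
  have h : (5 * (j + 1) ^ 2 - 3 * (j + 1)) / 2 = 1 + 5 * j + (5 * j ^ 2 - 3 * j) / 2 := by
    linarith [two_mul_expA j, two_mul_expA (j + 1)]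
  rw [termA, termA, h, zpow_add₀ hq, zpow_add₀ hq, zpow_add₀ (by norm_num), zpow_mul, zpow_one,
    zpow_one, zpow_ofNat]
  ring

theorem termB_succ {q : ℂ} (hq : q ≠ 0) (j : ℤ) :
    termB q (j + 1) = -q ^ 2 * (q ^ 5) ^ j * termB q j := by
  have h : (5 * (j + 1) ^ 2 - (j + 1)) / 2 = 2 + 5 * j + (5 * j ^ 2 - j) / 2 := by
    linarith [two_mul_expB j, two_mul_expB (j + 1)]
  rw [termB, termB, h, zpow_add₀ hq, zpow_add₀ hq, zpow_add₀ (by norm_num), zpow_mul, zpow_one,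
    zpow_ofNat, zpow_ofNat]
  ring

/-- Each series is P(q⁵) times its triple product. One of the two factors P(q⁵) completes the triple
products to P(q); the other remains. -/
theorem seriesA_mul_seriesB_eq_qProd {q : ℂ} (hq : ‖q‖ < 1) :
    seriesA q * seriesB q = qProd q * qProd (q ^ 5) := by
  rcases eq_or_ne q 0 with rfl | hq0
  · simp [seriesA_zero, seriesB_zero, qProd_zero]
  have hq5 := norm_pow_five_lt_one hq
  have hA := tendsto_triple_product hq5 (pow_ne_zero 5 hq0) hq0 (t := termA q) (by simp [termA])
    (termA_succ hq0) (summable_norm_termA hq)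
  have hB := tendsto_triple_product hq5 (pow_ne_zero 5 hq0) (pow_ne_zero 2 hq0) (t := termB q)
    (by simp [termB]) (termB_succ hq0) (summable_norm_termB hq)
  have h := (hA.mul hB).mul (tendsto_qFac hq5)
  simp only [triple_products_mul_qFac hq0] at h
  have h1 := tendsto_nhds_unique h (tendsto_qFac_mul hq (by norm_num))
  have h2 := qProd_ne_zero hq5
  rw [← h1, seriesA_eq, seriesB_eq]
  field_simp

/-! ### Products over the fifth roots of unity -/

theorem prod_sub_root_mul {w : ℂ} (hw : w ^ 5 = 1) (hw1 : w ≠ 1) (a b : ℂ) :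
    (a - b) * (a - w * b) * (a - w ^ 2 * b) * (a - w ^ 3 * b) * (a - w ^ 4 * b) =
      a ^ 5 - b ^ 5 := by
  have hs : 1 + w + w ^ 2 + w ^ 3 + w ^ 4 = 0 := by
    have h : (w - 1) * (1 + w + w ^ 2 + w ^ 3 + w ^ 4) = 0 := by linear_combination hw
    exact (mul_eq_zero.1 h).resolve_left (sub_ne_zero.2 hw1)
  have h1 : (a - w * b) * (a - w ^ 4 * b) = a ^ 2 - (w + w ^ 4) * a * b + b ^ 2 := by
    linear_combination b ^ 2 * hw
  have h2 : (a - w ^ 2 * b) * (a - w ^ 3 * b) = a ^ 2 - (w ^ 2 + w ^ 3) * a * b + b ^ 2 := by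
    linear_combination b ^ 2 * hw
  have h3 : w ^ 2 + w ^ 3 = -1 - (w + w ^ 4) := by linear_combination hs
  have h4 : (w + w ^ 4) ^ 2 = 1 - (w + w ^ 4) := by
    linear_combination hs + (2 + w ^ 3) * hw
  calc _ = (a - b) * ((a - w * b) * (a - w ^ 4 * b)) * ((a - w ^ 2 * b) * (a - w ^ 3 * b)) := by
        ring
    _ = _ := by
        rw [h1, h2, h3]
        generalize w + w ^ 4 = s at h4 ⊢
        linear_combination (-(a - b) * a ^ 2 * b ^ 2) * h4

/-- The exponents in a block are prime to 5, so raising to such an exponent permutes the fifth roots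
of unity and each factor 1 - q^m becomes 1 - q^{5m}. -/
theorem qBlock_root_of_unity {w : ℂ} (hw : IsPrimitiveRoot w 5) (q : ℂ) (n : ℕ) :
    qBlock q n * qBlock (w * q) n * qBlock (w ^ 2 * q) n * qBlock (w ^ 3 * q) n *
      qBlock (w ^ 4 * q) n = qBlock (q ^ 5) n := by
  have hw5 : w ^ 5 = 1 := hw.pow_eq_one
  simp only [qBlock, ← Finset.prod_mul_distrib]
  refine Finset.prod_congr rfl fun r hr => ?_
  rw [Finset.mem_range] at hr
  have h1 : w ^ (5 * n + (r + 1)) = w ^ (r + 1) := by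
    rw [pow_add, pow_mul, hw5, one_pow, one_mul]
  have h := prod_sub_root_mul (w := w ^ (r + 1))
    (by rw [← pow_mul, mul_comm, pow_mul, hw5, one_pow])
    (hw.pow_ne_one_of_pos_of_lt (by omega) (by omega)) 1 (q ^ (5 * n + (r + 1)))
  have hm : ∀ k, (w ^ k * q) ^ (5 * n + (r + 1)) =
      (w ^ (r + 1)) ^ k * q ^ (5 * n + (r + 1)) := fun k => by
    rw [mul_pow, ← pow_mul, mul_comm k, pow_mul, h1]
  have hm1 := hm 1
  rw [pow_one, pow_one] at hm1
  rw [hm1, hm 2, hm 3, hm 4, h, one_pow, ← pow_mul, ← pow_mul,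
    mul_comm (5 * n + (r + 1))]

/-- Factors with exponent divisible by 5 do not see the twist and contribute a fifth power. The
factor in q²⁵ restores the multiples of 5 missing from the blocks in q⁵. -/
theorem qFac_root_of_unity {w : ℂ} (hw : IsPrimitiveRoot w 5) (q : ℂ) (n : ℕ) :
    qFac q (5 * n) * qFac (w * q) (5 * n) * qFac (w ^ 2 * q) (5 * n) * qFac (w ^ 3 * q) (5 * n) *
      qFac (w ^ 4 * q) (5 * n) * qFac ((q ^ 5) ^ 5) n =
      qFac (q ^ 5) (5 * n) * qFac (q ^ 5) n ^ 5 := by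
  induction n with
  | zero => simp [qFac]
  | succ n ih =>
    have hw5 : w ^ 5 = 1 := hw.pow_eq_one
    have key0 : ∀ k, (w ^ k * q) ^ (5 * n + 5) = (q ^ 5) ^ (n + 1) := fun k => by
      rw [mul_pow, ← pow_mul, show k * (5 * n + 5) = 5 * (k * (n + 1)) by ring, pow_mul, hw5,
        one_pow, one_mul]
      ring
    have key1 := key0 1
    have key2 := key0 0
    rw [pow_one] at key1
    rw [pow_zero, one_mul] at key2
    have key3 : (q ^ 5) ^ (5 * n + 5) = ((q ^ 5) ^ 5) ^ (n + 1) := by ring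
    simp only [qFac_five_mul_succ, qFac_succ, key1, key2, key0, key3]
    rw [← qBlock_root_of_unity hw]
    generalize 1 - (q ^ 5) ^ (n + 1) = u
    generalize 1 - ((q ^ 5) ^ 5) ^ (n + 1) = v
    linear_combination u ^ 5 * v * (qBlock q n * qBlock (w * q) n * qBlock (w ^ 2 * q) n *
      qBlock (w ^ 3 * q) n * qBlock (w ^ 4 * q) n) * ih

theorem qProd_root_of_unity {w : ℂ} (hw : IsPrimitiveRoot w 5) {q : ℂ} (hq : ‖q‖ < 1) :
    qProd q * qProd (w * q) * qProd (w ^ 2 * q) * qProd (w ^ 3 * q) * qProd (w ^ 4 * q) *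
      qProd ((q ^ 5) ^ 5) = qProd (q ^ 5) * qProd (q ^ 5) ^ 5 := by
  have hw1 : ‖w‖ = 1 := hw.norm'_eq_one (by norm_num)
  have hk : ∀ k, ‖w ^ k * q‖ < 1 := fun k => by
    rwa [norm_mul, norm_pow, hw1, one_pow, one_mul]
  have hk1 := hk 1
  rw [pow_one] at hk1
  have hq5 := norm_pow_five_lt_one hq
  have h5 : 0 < 5 := by norm_num
  have hL := (((((tendsto_qFac_mul hq h5).mul (tendsto_qFac_mul hk1 h5)).mul
    (tendsto_qFac_mul (hk 2) h5)).mul (tendsto_qFac_mul (hk 3) h5)).mul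
    (tendsto_qFac_mul (hk 4) h5)).mul (tendsto_qFac (norm_pow_five_lt_one hq5))
  have hR := (tendsto_qFac_mul hq5 h5).mul ((tendsto_qFac hq5).pow 5)
  exact tendsto_nhds_unique hL (hR.congr fun n => (qFac_root_of_unity hw q n).symm)

theorem α_add_β : α + β = 1 := by rw [α, β]; ring

theorem α_mul_β : α * β = -1 := by
  have h : √5 ^ 2 = 5 := Real.sq_sqrt (by norm_num)
  rw [α, β]
  linear_combination (-1 / 4) * h

/-- The icosahedral relation between the theta series and the eta product. -/
theorem qProd_pow_eleven {q : ℂ} (hq : ‖q‖ < 1) :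
    qProd (q ^ 5) * (seriesB q ^ 10 - 11 * q * seriesA q ^ 5 * seriesB q ^ 5 -
      q ^ 2 * seriesA q ^ 10) = qProd q ^ 11 := by
  obtain ⟨s, rfl⟩ := IsAlgClosed.exists_pow_nat_eq q (n := 5) (by norm_num)
  have hs : ‖s‖ < 1 := by
    rw [norm_pow] at hq
    exact lt_of_not_ge fun h => hq.not_ge (one_le_pow₀ h)
  obtain ⟨w, hw⟩ : ∃ w : ℂ, IsPrimitiveRoot w 5 :=
    ⟨_, Complex.isPrimitiveRoot_exp 5 (by norm_num)⟩
  have hw1 : ‖w‖ = 1 := hw.norm'_eq_one (by norm_num)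
  have hw5 : w ^ 5 = 1 := hw.pow_eq_one
  have hwne : w ≠ 1 := hw.ne_one (by norm_num)
  set F := seriesA (s ^ 5)
  set G := seriesB (s ^ 5)
  obtain ⟨x, y, hxy, hxy1⟩ : ∃ x y : ℂ, x + y = 1 ∧ x * y = -1 :=
    ⟨α, β, by exact_mod_cast α_add_β, by exact_mod_cast α_mul_β⟩
  -- Twisting s by wᵏ leaves s⁵ unchanged, so the dissection at all five points involves the same F
  -- and G. The numbers x, y split its quadratic form into linear factors.
  have hk : ∀ k, qProd (w ^ k * s) * qProd (s ^ 5) =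
      (G - w ^ k * (x * s * F)) * (G - w ^ k * (y * s * F)) := fun k => by
    have h1 : ‖w ^ k * s‖ < 1 := by rwa [norm_mul, norm_pow, hw1, one_pow, one_mul]
    have h2 : (w ^ k * s) ^ 5 = s ^ 5 := by
      rw [mul_pow, ← pow_mul, mul_comm k, pow_mul, hw5, one_pow, one_mul]
    have h3 := (seriesA_mul_seriesB_eq_qProd h1).symm.trans (seriesA_mul_seriesB h1)
    rw [h2] at h3
    rw [h3]
    linear_combination w ^ k * s * F * G * hxy - (w ^ k * s * F) ^ 2 * hxy1
  have h0 := hk 0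
  have h1 := hk 1
  simp only [pow_zero, pow_one, one_mul] at h0 h1
  have hx := prod_sub_root_mul hw5 hwne G (x * s * F)
  have hy := prod_sub_root_mul hw5 hwne G (y * s * F)
  have hP := qProd_root_of_unity hw hs
  have hprod : (qProd s * qProd (w * s) * qProd (w ^ 2 * s) * qProd (w ^ 3 * s) *
      qProd (w ^ 4 * s)) * qProd (s ^ 5) ^ 5 =
      (G ^ 5 - (x * s * F) ^ 5) * (G ^ 5 - (y * s * F) ^ 5) := by
    rw [← hx, ← hy]
    calc _ = (qProd s * qProd (s ^ 5)) * (qProd (w * s) * qProd (s ^ 5)) *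
          (qProd (w ^ 2 * s) * qProd (s ^ 5)) * (qProd (w ^ 3 * s) * qProd (s ^ 5)) *
          (qProd (w ^ 4 * s) * qProd (s ^ 5)) := by ring
      _ = _ := by rw [h0, h1, hk 2, hk 3, hk 4]; ring
  have hform : (G ^ 5 - (x * s * F) ^ 5) * (G ^ 5 - (y * s * F) ^ 5) =
      G ^ 10 - 11 * s ^ 5 * F ^ 5 * G ^ 5 - (s ^ 5) ^ 2 * F ^ 10 := by
    -- The coefficient 11 is the fifth Lucas number α⁵ + β⁵.
    have e1 : x ^ 5 + y ^ 5 = 11 := by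
      have : y = 1 - x := by linear_combination hxy
      subst this
      linear_combination (5 * (x * (1 - x)) - 10) * hxy1
    have e2 : x ^ 5 * y ^ 5 = -1 := by rw [← mul_pow, hxy1]; norm_num
    linear_combination (-(s * F * G) ^ 5) * e1 + (s * F) ^ 10 * e2
  rw [hform] at hprod
  rw [← hprod]
  linear_combination qProd (s ^ 5) ^ 5 * hP

/-! ### Analyticity and the quintic transformation -/

/-- Differentiability is local, so it suffices to have a majorant on each disc of radius r < 1,
where geometric ones are available. -/
theorem differentiableAt_tsum_of_norm_le {ι : Type*} {F : ι → ℂ → ℂ}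
    (hF : ∀ i, DifferentiableOn ℂ (F i) (Metric.ball 0 1))
    (hu : ∀ r : ℝ, 0 ≤ r → r < 1 → ∃ u : ι → ℝ, Summable u ∧
      ∀ i w, ‖w‖ ≤ r → ‖F i w‖ ≤ u i) {q : ℂ} (hq : ‖q‖ < 1) :
    DifferentiableAt ℂ (fun w => ∑' i, F i w) q := by
  obtain ⟨r, hqr, hr⟩ := exists_between hq
  obtain ⟨u, hu, hFu⟩ := hu r ((norm_nonneg q).trans hqr.le) hr
  have h := Complex.differentiableOn_tsum_of_summable_norm (U := Metric.ball (0 : ℂ) r) hu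
    (fun i => (hF i).mono (Metric.ball_subset_ball hr.le)) Metric.isOpen_ball
    (fun i w hw => hFu i w (mem_ball_zero_iff.1 hw).le)
  exact h.differentiableAt (Metric.isOpen_ball.mem_nhds (mem_ball_zero_iff.2 hqr))

theorem differentiable_sign_mul_zpow (n e : ℤ) (h : (n.natAbs : ℤ) ≤ e) :
    Differentiable ℂ fun q : ℂ => (-1) ^ n * q ^ e := by
  obtain ⟨k, rfl⟩ : ∃ k : ℕ, e = k := ⟨e.toNat, by omega⟩
  simp only [zpow_natCast]
  fun_prop

theorem differentiableAt_seriesA {q : ℂ} (hq : ‖q‖ < 1) :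
    DifferentiableAt ℂ (fun q : ℂ => seriesA q) q :=
  differentiableAt_tsum_of_norm_le (F := fun n q => termA q n)
    (fun n => (differentiable_sign_mul_zpow n _ (natAbs_le_expA n)).differentiableOn)
    (fun _ hr0 hr => ⟨_, summable_pow_natAbs hr0 hr, fun n _ hw => norm_termA_le hw hr n⟩) hq

theorem differentiableAt_seriesB {q : ℂ} (hq : ‖q‖ < 1) :
    DifferentiableAt ℂ (fun q : ℂ => seriesB q) q :=
  differentiableAt_tsum_of_norm_le (F := fun n q => termB q n)
    (fun n => (differentiable_sign_mul_zpow n _ (natAbs_le_expB n)).differentiableOn)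
    (fun _ hr0 hr => ⟨_, summable_pow_natAbs hr0 hr, fun n _ hw => norm_termB_le hw hr n⟩) hq

theorem norm_log_one_sub_pow_le {q : ℂ} {r : ℝ} (hqr : ‖q‖ ≤ r) (hr : r < 1) (n : ℕ) :
    ‖Complex.log (1 - q ^ (n + 1))‖ ≤ r ^ n * ((1 - r)⁻¹ / 2 + 1) := by
  have hr0 : 0 ≤ r := (norm_nonneg q).trans hqr
  have h1 : ‖-q ^ (n + 1)‖ ≤ r ^ (n + 1) := by
    rw [norm_neg, norm_pow]
    exact pow_le_pow_left₀ (norm_nonneg q) hqr _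
  have h2 : r ^ (n + 1) ≤ r := by
    simpa using pow_le_pow_of_le_one hr0 hr.le (show 1 ≤ n + 1 by omega)
  have h3 : r ^ (n + 1) ≤ r ^ n := pow_le_pow_of_le_one hr0 hr.le (by omega)
  have h := Complex.norm_log_one_add_le (z := -q ^ (n + 1)) ((h1.trans h2).trans_lt hr)
  rw [← sub_eq_add_neg] at h
  refine h.trans ?_
  set x := ‖-q ^ (n + 1)‖
  have hx0 : 0 ≤ x := norm_nonneg _
  have hx1 : x ≤ 1 := (h1.trans h2).trans hr.le
  have hxn : x ≤ r ^ n := h1.trans h3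
  have h4 : (1 - x)⁻¹ ≤ (1 - r)⁻¹ := by
    gcongr
    exact h1.trans h2
  have h5 : 0 ≤ (1 - r)⁻¹ := inv_nonneg.2 (by linarith)
  have h6 : x ^ 2 ≤ r ^ n := by nlinarith
  calc x ^ 2 * (1 - x)⁻¹ / 2 + x ≤ r ^ n * (1 - r)⁻¹ / 2 + r ^ n := by gcongr
    _ = _ := by ring

theorem differentiableAt_qProdPow (s : ℂ) {q : ℂ} (hq : ‖q‖ < 1) :
    DifferentiableAt ℂ (fun q : ℂ => qProdPow s q) q := by
  have h : DifferentiableAt ℂ (fun q : ℂ => ∑' n : ℕ, Complex.log (1 - q ^ (n + 1))) q := by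
    refine differentiableAt_tsum_of_norm_le (F := fun n q => Complex.log (1 - q ^ (n + 1)))
      (fun n w hw => ?_) (fun r hr0 hr => ⟨_, (summable_geometric_of_lt_one hr0 hr).mul_right _,
        fun n _ hw => norm_log_one_sub_pow_le hw hr n⟩) hq
    have hw1 : ‖w ^ (n + 1)‖ < 1 := by
      rw [norm_pow]
      exact pow_lt_one₀ (norm_nonneg w) (mem_ball_zero_iff.1 hw) n.succ_ne_zero
    refine DifferentiableAt.differentiableWithinAt (DifferentiableAt.clog (by fun_prop) ?_)
    rw [sub_eq_add_neg]
    exact Complex.mem_slitPlane_of_norm_lt_one (by rwa [norm_neg])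
  exact (h.const_mul s).cexp

theorem differentiableAt_qProd {q : ℂ} (hq : ‖q‖ < 1) :
    DifferentiableAt ℂ (fun q : ℂ => qProd q) q := by
  refine (differentiableAt_qProdPow 1 hq).congr_of_eventuallyEq ?_
  filter_upwards [Metric.isOpen_ball.mem_nhds (mem_ball_zero_iff.2 hq)] with w hw
  exact (qProdPow_one w (mem_ball_zero_iff.1 hw)).symm

/-- Two holomorphic functions on the unit disc whose squares agree and that agree at the origin
with a nonzero value are equal. -/
theorem eq_of_sq_eq_sq_of_differentiableAt {h k : ℂ → ℂ}
    (hh : ∀ q, ‖q‖ < 1 → DifferentiableAt ℂ h q) (hk : ∀ q, ‖q‖ < 1 → DifferentiableAt ℂ k q)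
    (hsq : ∀ q, ‖q‖ < 1 → h q ^ 2 = k q ^ 2) (h0 : h 0 + k 0 ≠ 0) {q : ℂ} (hq : ‖q‖ < 1) :
    h q = k q := by
  have ha : ∀ {f : ℂ → ℂ}, (∀ q, ‖q‖ < 1 → DifferentiableAt ℂ f q) →
      AnalyticOnNhd ℂ f (Metric.ball 0 1) := fun hf =>
    DifferentiableOn.analyticOnNhd
      (fun w hw => (hf w (mem_ball_zero_iff.1 hw)).differentiableWithinAt) Metric.isOpen_ball
  have hb : Metric.ball (0 : ℂ) 1 ∈ 𝓝 0 := Metric.ball_mem_nhds 0 one_pos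
  have hev : h =ᶠ[𝓝 0] k := by
    have hc : ContinuousAt (fun q => h q + k q) 0 :=
      ((hh 0 (by simp)).continuousAt).add ((hk 0 (by simp)).continuousAt)
    filter_upwards [hc.eventually_ne h0, hb] with w hw hw1
    have h1 : (h w + k w) * (h w - k w) = 0 := by
      linear_combination hsq w (mem_ball_zero_iff.1 hw1)
    exact sub_eq_zero.1 ((mul_eq_zero.1 h1).resolve_left hw)
  exact (ha hh).eqOn_of_preconnected_of_eventuallyEq (ha hk)
    (convex_ball (0 : ℂ) 1).isPreconnected (Metric.mem_ball_self one_pos) hev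
    (mem_ball_zero_iff.2 hq)

theorem formA_mul_formB {R : Type*} [CommRing R] (a b : R) :
    formA a b * formB a b * (b ^ 2 - a * b - a ^ 2) =
      a * b * (b ^ 10 - 11 * a ^ 5 * b ^ 5 - a ^ 10) := by
  rw [formA, formB]
  ring

/-- This is the product over c = α, β of the identity in `sub_mul_pow_five`, since α⁵ + β⁵ = 11 and
αβ = -1. -/
theorem formB_sq_sub {R : Type*} [CommRing R] (a b : R) :
    formB a b ^ 2 - 11 * (formA a b * formB a b) - formA a b ^ 2 =
      (b ^ 2 - a * b - a ^ 2) ^ 5 := by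
  rw [formA, formB]
  ring

theorem qProd_mul_qProd_pow_five {q : ℂ} (hq : ‖q‖ < 1) :
    seriesB (q ^ 5) ^ 2 - (q * seriesA (q ^ 5)) * seriesB (q ^ 5) - (q * seriesA (q ^ 5)) ^ 2 =
      qProd q * qProd (q ^ 5) := by
  rw [← seriesA_mul_seriesB_eq_qProd hq, seriesA_mul_seriesB hq]
  ring

/-- Both sides equal qP(q)⁵P(q⁵)¹¹. On the right this uses `formA_mul_formB` and the degree-ten
relation at q⁵. -/
theorem quintic_mul {q : ℂ} (hq : ‖q‖ < 1) :
    (q * qProd (q ^ 5) ^ 3 * seriesA q ^ 5) * (qProd (q ^ 5) ^ 3 * seriesB q ^ 5) =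
      (qProd q ^ 3 * formA (q * seriesA (q ^ 5)) (seriesB (q ^ 5))) *
      (qProd q ^ 3 * formB (q * seriesA (q ^ 5)) (seriesB (q ^ 5))) := by
  have hq5 := norm_pow_five_lt_one hq
  have hP5 := qProd_ne_zero hq5
  have h1 := qProd_mul_qProd_pow_five hq
  have h2 := formA_mul_formB (q * seriesA (q ^ 5)) (seriesB (q ^ 5))
  have h3 := qProd_pow_eleven hq5
  have h4 := seriesA_mul_seriesB_eq_qProd hq
  have h5 := seriesA_mul_seriesB_eq_qProd hq5
  rw [h1] at h2
  have h6 : q * seriesA (q ^ 5) * seriesB (q ^ 5) * (seriesB (q ^ 5) ^ 10 -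
      11 * (q * seriesA (q ^ 5)) ^ 5 * seriesB (q ^ 5) ^ 5 - (q * seriesA (q ^ 5)) ^ 10) =
      q * qProd (q ^ 5) ^ 12 := by
    linear_combination q * (seriesB (q ^ 5) ^ 10 -
      11 * (q * seriesA (q ^ 5)) ^ 5 * seriesB (q ^ 5) ^ 5 - (q * seriesA (q ^ 5)) ^ 10) * h5 +
      q * qProd (q ^ 5) * h3
  rw [h6] at h2
  have h7 : formA (q * seriesA (q ^ 5)) (seriesB (q ^ 5)) *
      formB (q * seriesA (q ^ 5)) (seriesB (q ^ 5)) * qProd q = q * qProd (q ^ 5) ^ 11 :=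
    mul_right_cancel₀ hP5 (by linear_combination h2)
  calc _ = q * qProd (q ^ 5) ^ 6 * (seriesA q * seriesB q) ^ 5 := by ring
    _ = _ := by rw [h4]; linear_combination -qProd q ^ 5 * h7

/-- Both sides equal P(q)¹¹P(q⁵)⁵. -/
theorem quintic_sq_sub {q : ℂ} (hq : ‖q‖ < 1) :
    (qProd (q ^ 5) ^ 3 * seriesB q ^ 5) ^ 2 -
      11 * ((q * qProd (q ^ 5) ^ 3 * seriesA q ^ 5) * (qProd (q ^ 5) ^ 3 * seriesB q ^ 5)) -
      (q * qProd (q ^ 5) ^ 3 * seriesA q ^ 5) ^ 2 =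
    (qProd q ^ 3 * formB (q * seriesA (q ^ 5)) (seriesB (q ^ 5))) ^ 2 -
      11 * ((qProd q ^ 3 * formA (q * seriesA (q ^ 5)) (seriesB (q ^ 5))) *
      (qProd q ^ 3 * formB (q * seriesA (q ^ 5)) (seriesB (q ^ 5)))) -
      (qProd q ^ 3 * formA (q * seriesA (q ^ 5)) (seriesB (q ^ 5))) ^ 2 := by
  have h1 := formB_sq_sub (q * seriesA (q ^ 5)) (seriesB (q ^ 5))
  rw [qProd_mul_qProd_pow_five hq] at h1
  linear_combination qProd (q ^ 5) ^ 5 * qProd_pow_eleven hq - qProd q ^ 6 * h1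

/-- Since c² = -1, (Y + cX)² = Y² - X² + 2cXY is determined by the two invariants just computed. The
choices c = ±i then recover X and Y separately. -/
theorem quintic_add_mul {c : ℂ} (hc : c ^ 2 = -1) {q : ℂ} (hq : ‖q‖ < 1) :
    qProd (q ^ 5) ^ 3 * seriesB q ^ 5 + c * (q * qProd (q ^ 5) ^ 3 * seriesA q ^ 5) =
      qProd q ^ 3 * formB (q * seriesA (q ^ 5)) (seriesB (q ^ 5)) +
        c * (qProd q ^ 3 * formA (q * seriesA (q ^ 5)) (seriesB (q ^ 5))) := by
  have hd : ∀ {f : ℂ → ℂ}, (∀ q, ‖q‖ < 1 → DifferentiableAt ℂ f q) →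
      ∀ q, ‖q‖ < 1 → DifferentiableAt ℂ (fun q => f (q ^ 5)) q := fun hf q hq =>
    DifferentiableAt.comp q (hf _ (norm_pow_five_lt_one hq)) (by fun_prop)
  refine eq_of_sq_eq_sq_of_differentiableAt
    (h := fun q => qProd (q ^ 5) ^ 3 * seriesB q ^ 5 +
      c * (q * qProd (q ^ 5) ^ 3 * seriesA q ^ 5))
    (k := fun q => qProd q ^ 3 * formB (q * seriesA (q ^ 5)) (seriesB (q ^ 5)) +
        c * (qProd q ^ 3 * formA (q * seriesA (q ^ 5)) (seriesB (q ^ 5))))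
    (fun q hq => ?_) (fun q hq => ?_) (fun q hq => ?_) ?_ hq
  · have := hd (fun _ => differentiableAt_qProd) q hq
    have := differentiableAt_seriesA hq
    have := differentiableAt_seriesB hq
    fun_prop
  · have := hd (fun _ => differentiableAt_seriesA) q hq
    have := hd (fun _ => differentiableAt_seriesB) q hq
    have := differentiableAt_qProd hq
    unfold formA formB
    fun_prop
  · have h1 := quintic_mul hq
    have h2 := quintic_sq_sub hq
    have h3 : ∀ X Y X' Y' : ℂ, X * Y = X' * Y' →
        Y ^ 2 - 11 * (X * Y) - X ^ 2 = Y' ^ 2 - 11 * (X' * Y') - X' ^ 2 →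
        (Y + c * X) ^ 2 = (Y' + c * X') ^ 2 := fun X Y X' Y' h1 h2 => by
      linear_combination h2 + (11 + 2 * c) * h1 + (X ^ 2 - X' ^ 2) * hc
    exact h3 _ _ _ _ h1 h2
  · norm_num [seriesA_zero, seriesB_zero, qProd_zero, formA, formB]

theorem quintic_seriesA {q : ℂ} (hq : ‖q‖ < 1) :
    q * qProd (q ^ 5) ^ 3 * seriesA q ^ 5 =
      qProd q ^ 3 * formA (q * seriesA (q ^ 5)) (seriesB (q ^ 5)) := by
  have h1 := quintic_add_mul Complex.I_sq hq
  have h2 := quintic_add_mul (c := -Complex.I) (by rw [neg_sq, Complex.I_sq]) hq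
  exact mul_left_cancel₀ (mul_ne_zero two_ne_zero Complex.I_ne_zero) (by
    linear_combination h1 - h2)

theorem quintic_seriesB {q : ℂ} (hq : ‖q‖ < 1) :
    qProd (q ^ 5) ^ 3 * seriesB q ^ 5 =
      qProd q ^ 3 * formB (q * seriesA (q ^ 5)) (seriesB (q ^ 5)) := by
  have h1 := quintic_add_mul Complex.I_sq hq
  have h2 := quintic_add_mul (c := -Complex.I) (by rw [neg_sq, Complex.I_sq]) hq
  exact mul_left_cancel₀ (two_ne_zero (α := ℂ)) (by linear_combination h1 + h2)

/-! ### Algebraic consequences -/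

section Field

variable {K : Type*} [Field K]

/-- Here p and p₅ stand for the powers -3/5 of P and P₅. Only their fifth powers matter, so the real
power and the complex branch are treated alike. -/
theorem mul_pow_five_of_quintic {P P₅ p p₅ x N : K} (hp : p ^ 5 * P ^ 3 = 1)
    (hp₅ : p₅ ^ 5 * P₅ ^ 3 = 1) (h : P₅ ^ 3 * x = P ^ 3 * N) : p ^ 5 * x = p₅ ^ 5 * N := by
  linear_combination p ^ 5 * p₅ ^ 5 * h + p₅ ^ 5 * N * hp - p ^ 5 * x * hp₅

theorem formA_mul_mul (p a b : K) : formA (p * a) (p * b) = p ^ 5 * formA a b := by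
  rw [formA, formA]; ring

theorem formB_mul_mul (p a b : K) : formB (p * a) (p * b) = p ^ 5 * formB a b := by
  rw [formB, formB]; ring

/-- Reducing the powers of c to Fibonacci combinations of c and 1 turns the binomial expansion into
the two forms. This identity inverts the quintic transformation. -/
theorem sub_mul_pow_five {c : K} (hc : c ^ 2 = c + 1) (a b : K) :
    (b - c * a) ^ 5 = formB a b - c ^ 5 * formA a b := by
  have h5 : c ^ 5 = 5 * c + 3 := by linear_combination (c ^ 3 + c ^ 2 + 2 * c + 3) * hc
  have h4 : c ^ 4 = 3 * c + 2 := by linear_combination (c ^ 2 + c + 2) * hc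
  have h3 : c ^ 3 = 2 * c + 1 := by linear_combination (c + 1) * hc
  have h : (b - c * a) ^ 5 = b ^ 5 - 5 * c * b ^ 4 * a + 10 * c ^ 2 * b ^ 3 * a ^ 2 -
      10 * c ^ 3 * b ^ 2 * a ^ 3 + 5 * c ^ 4 * b * a ^ 4 - c ^ 5 * a ^ 5 := by ring
  rw [h, h5, h4, h3, hc, formA, formB]
  ring

end Field

theorem α_sq : α ^ 2 = α + 1 := by linear_combination α * α_add_β - α_mul_β

theorem β_sq : β ^ 2 = β + 1 := by linear_combination β * α_add_β - α_mul_β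

theorem β_sub_α_ne_zero : β - α ≠ 0 := by
  have h : β - α = -√5 := by rw [α, β]; ring
  rw [h, neg_ne_zero]
  positivity

/-! ### Real `q` -/

theorem ofReal_qProd {q : ℝ} (hq : |q| < 1) : ((qProd q : ℝ) : ℂ) = qProd (q : ℂ) := by
  have h := ((multipliable_one_sub_pow (q := q) hq).hasProd.map Complex.ofRealHom
    Complex.continuous_ofReal).tprod_eq
  simpa [qProd, Function.comp_def] using h.symm

theorem ofReal_seriesA (q : ℝ) : ((seriesA q : ℝ) : ℂ) = seriesA (q : ℂ) := by
  rw [seriesA, seriesA, Complex.ofReal_tsum]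
  push_cast
  rfl

theorem ofReal_seriesB (q : ℝ) : ((seriesB q : ℝ) : ℂ) = seriesB (q : ℂ) := by
  rw [seriesB, seriesB, Complex.ofReal_tsum]
  push_cast
  rfl

theorem qProd_pos {q : ℝ} (hq : |q| < 1) : 0 < qProd q := by
  refine lt_of_le_of_ne ?_ fun h => qProd_ne_zero (q := q) (by simpa using hq) ?_
  · refine ge_of_tendsto' (multipliable_one_sub_pow (q := q) hq).hasProd.tendsto_prod_nat
      fun n => Finset.prod_nonneg fun k _ => ?_
    have h1 : |q ^ (k + 1)| ≤ 1 := by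
      rw [abs_pow]
      exact pow_le_one₀ (abs_nonneg q) hq.le
    linarith [(abs_le.1 h1).2]
  · rw [← ofReal_qProd hq, ← h, Complex.ofReal_zero]

theorem rpow_qProd_pow_five {q : ℝ} (hq : |q| < 1) :
    (qProd q ^ (-(3 / 5) : ℝ)) ^ 5 * qProd q ^ 3 = 1 := by
  have h := qProd_pos hq
  rw [← Real.rpow_natCast, ← Real.rpow_mul h.le, ← Real.rpow_natCast _ 3, ← Real.rpow_add h]
  norm_num

/-- The fifth power is injective on ℝ, so in the real setting identities between fifth powers
already determine the roots. -/
theorem fifthRoot_pow_five (x : ℝ) : fifthRoot (x ^ 5) = x :=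
  (Odd.pow_inj (n := 5) (by decide)).1 (fifthRoot_pow _)

theorem abs_pow_five_lt_one {q : ℝ} (hq : |q| < 1) : |q ^ 5| < 1 := by
  rw [abs_pow]
  exact pow_lt_one₀ (abs_nonneg q) hq (by norm_num)

theorem abs_fifthRoot_lt_one {q : ℝ} (hq : |q| < 1) : |fifthRoot q| < 1 := by
  rw [← fifthRoot_pow q, abs_pow] at hq
  exact lt_of_not_ge fun h => hq.not_ge (one_le_pow₀ h)

theorem realA_pow_five {q : ℝ} (hq : |q| < 1) :
    realA q ^ 5 = formA (realA (q ^ 5)) (realB (q ^ 5)) := by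
  have hq5 := abs_pow_five_lt_one hq
  have h : qProd (q ^ 5) ^ 3 * (q * seriesA q ^ 5) =
      qProd q ^ 3 * formA (q * seriesA (q ^ 5)) (seriesB (q ^ 5)) := by
    have h := quintic_seriesA (q := q) (by simpa using hq)
    rw [← Complex.ofReal_inj]
    simp only [formA] at h ⊢
    push_cast [ofReal_qProd hq, ofReal_qProd hq5, ofReal_seriesA, ofReal_seriesB]
    linear_combination h
  have h1 := mul_pow_five_of_quintic (rpow_qProd_pow_five hq) (rpow_qProd_pow_five hq5) h
  rw [← formA_mul_mul] at h1
  simp only [realA, realB, fifthRoot_pow_five, mul_pow, fifthRoot_pow]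
  rw [← mul_assoc, mul_comm _ q] at h1
  rw [h1, mul_left_comm, mul_assoc]

theorem realB_pow_five {q : ℝ} (hq : |q| < 1) :
    realB q ^ 5 = formB (realA (q ^ 5)) (realB (q ^ 5)) := by
  have hq5 := abs_pow_five_lt_one hq
  have h : qProd (q ^ 5) ^ 3 * seriesB q ^ 5 =
      qProd q ^ 3 * formB (q * seriesA (q ^ 5)) (seriesB (q ^ 5)) := by
    have h := quintic_seriesB (q := q) (by simpa using hq)
    rw [← Complex.ofReal_inj]
    simp only [formB] at h ⊢
    push_cast [ofReal_qProd hq, ofReal_qProd hq5, ofReal_seriesA, ofReal_seriesB]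
    linear_combination h
  have h1 := mul_pow_five_of_quintic (rpow_qProd_pow_five hq) (rpow_qProd_pow_five hq5) h
  rw [← formB_mul_mul] at h1
  simp only [realA, realB, fifthRoot_pow_five, mul_pow]
  rw [h1, mul_left_comm, mul_assoc]

theorem realA_fifthRoot {q : ℝ} (hq : |q| < 1) :
    realA (fifthRoot q) = calA (realA q) (realB q) := by
  have h := realA_pow_five (abs_fifthRoot_lt_one hq)
  rw [fifthRoot_pow] at h
  rw [calA, ← h, fifthRoot_pow_five]

theorem realB_fifthRoot {q : ℝ} (hq : |q| < 1) :
    realB (fifthRoot q) = calB (realA q) (realB q) := by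
  have h := realB_pow_five (abs_fifthRoot_lt_one hq)
  rw [fifthRoot_pow] at h
  rw [calB, ← h, fifthRoot_pow_five]

theorem fifthRoot_realB_sub {c : ℝ} (hc : c ^ 2 = c + 1) {q : ℝ} (hq : |q| < 1) :
    fifthRoot (realB q ^ 5 - c ^ 5 * realA q ^ 5) = realB (q ^ 5) - c * realA (q ^ 5) := by
  rw [realA_pow_five hq, realB_pow_five hq, ← sub_mul_pow_five hc, fifthRoot_pow_five]

theorem realA_pow {q : ℝ} (hq : |q| < 1) : realA (q ^ 5) = calC (realA q) (realB q) := by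
  rw [calC, fifthRoot_realB_sub α_sq hq, fifthRoot_realB_sub β_sq hq,
    eq_div_iff β_sub_α_ne_zero]
  ring

theorem realB_pow {q : ℝ} (hq : |q| < 1) : realB (q ^ 5) = calD (realA q) (realB q) := by
  rw [calD, fifthRoot_realB_sub α_sq hq, fifthRoot_realB_sub β_sq hq,
    eq_div_iff β_sub_α_ne_zero]
  ring

/-! ### Complex `q` -/

theorem nome_pow_five (τ : ℂ) : nome τ ^ 5 = nome (5 * τ) := by
  rw [nome, nome, ← Complex.exp_nat_mul]
  congr 1
  push_cast
  ring

theorem norm_nome (τ : ℂ) : ‖nome τ‖ = Real.exp (-(2 * Real.pi * τ.im)) := by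
  rw [nome, Complex.norm_exp]
  congr 1
  simp [Complex.mul_re, Complex.mul_im]

theorem norm_nome_lt_one {τ : ℂ} (hτ : 0 < τ.im) : ‖nome τ‖ < 1 := by
  rw [norm_nome, Real.exp_lt_one_iff]
  have := Real.pi_pos
  have : 0 < 2 * Real.pi * τ.im := by positivity
  linarith

theorem continuous_nome : Continuous nome := by
  unfold nome
  fun_prop

theorem nome_ne_zero (τ : ℂ) : nome τ ≠ 0 := Complex.exp_ne_zero _

theorem qProdPow_ne_zero (s q : ℂ) : qProdPow s q ≠ 0 := Complex.exp_ne_zero _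

theorem qProdPow_pow_five {q : ℂ} (hq : ‖q‖ < 1) :
    qProdPow (-(3 / 5)) q ^ 5 * qProd q ^ 3 = 1 := by
  rw [← qProdPow_one q hq, qProdPow, qProdPow, ← Complex.exp_nat_mul, ← Complex.exp_nat_mul,
    ← Complex.exp_add]
  convert Complex.exp_zero using 2
  push_cast
  ring

theorem thetaA_pow_five {τ : ℂ} (hτ : 0 < τ.im) :
    thetaA τ ^ 5 = formA (thetaA (5 * τ)) (thetaB (5 * τ)) := by
  have hq := norm_nome_lt_one hτ
  have h : qProd (nome τ ^ 5) ^ 3 * (nome τ * seriesA (nome τ) ^ 5) =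
      qProd (nome τ) ^ 3 * formA (nome τ * seriesA (nome τ ^ 5)) (seriesB (nome τ ^ 5)) := by
    rw [← quintic_seriesA hq]
    ring
  have h1 := mul_pow_five_of_quintic (qProdPow_pow_five hq)
    (qProdPow_pow_five (norm_pow_five_lt_one hq)) h
  rw [← formA_mul_mul, nome_pow_five] at h1
  have h2 : nome (τ / 5) ^ 5 = nome τ := by rw [nome_pow_five]; congr 1; ring
  have h3 : 5 * τ / 5 = τ := by ring
  rw [thetaA, thetaA, thetaB, h3, mul_pow, mul_pow, h2, mul_assoc (nome τ) (qProdPow _ _),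
    mul_left_comm (nome τ) (qProdPow _ _), ← h1]
  ring

theorem thetaB_pow_five {τ : ℂ} (hτ : 0 < τ.im) :
    thetaB τ ^ 5 = formB (thetaA (5 * τ)) (thetaB (5 * τ)) := by
  have hq := norm_nome_lt_one hτ
  have h1 := mul_pow_five_of_quintic (qProdPow_pow_five hq)
    (qProdPow_pow_five (norm_pow_five_lt_one hq)) (quintic_seriesB hq)
  rw [← formB_mul_mul, nome_pow_five] at h1
  have h3 : 5 * τ / 5 = τ := by ring
  rw [thetaA, thetaB, thetaB, h3, mul_pow, mul_assoc (nome τ) (qProdPow _ _),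
    mul_left_comm (nome τ) (qProdPow _ _), ← h1]

/-- The product formula keeps both series free of zeros, hence also the radicands of 𝒜 and ℬ, as
uniqueness of the branches requires. -/
theorem seriesA_mul_seriesB_ne_zero {q : ℂ} (hq : ‖q‖ < 1) : seriesA q * seriesB q ≠ 0 := by
  rw [seriesA_mul_seriesB_eq_qProd hq]
  exact mul_ne_zero (qProd_ne_zero hq) (qProd_ne_zero (norm_pow_five_lt_one hq))

theorem thetaA_ne_zero {τ : ℂ} (hτ : 0 < τ.im) : thetaA τ ≠ 0 :=
  mul_ne_zero (mul_ne_zero (nome_ne_zero _) (qProdPow_ne_zero _ _))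
    (left_ne_zero_of_mul (seriesA_mul_seriesB_ne_zero (norm_nome_lt_one hτ)))

theorem thetaB_ne_zero {τ : ℂ} (hτ : 0 < τ.im) : thetaB τ ≠ 0 :=
  mul_ne_zero (qProdPow_ne_zero _ _)
    (right_ne_zero_of_mul (seriesA_mul_seriesB_ne_zero (norm_nome_lt_one hτ)))

/-- With d the conjugate of c, the expression is a linear factor of the quadratic form b² - ab - a²,
which by the dissection is a product of nonvanishing terms. -/
theorem thetaB_sub_ne_zero {c d : ℂ} (h1 : c + d = 1) (h2 : c * d = -1) {τ : ℂ}
    (hτ : 0 < τ.im) : thetaB (5 * τ) - c * thetaA (5 * τ) ≠ 0 := by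
  have hq := norm_nome_lt_one hτ
  have h3 : 5 * τ / 5 = τ := by ring
  have h : (thetaB (5 * τ) - c * thetaA (5 * τ)) * (thetaB (5 * τ) - d * thetaA (5 * τ)) =
      qProdPow (-(3 / 5)) (nome (5 * τ)) ^ 2 * (qProd (nome τ) * qProd (nome τ ^ 5)) := by
    rw [← qProd_mul_qProd_pow_five hq, thetaA, thetaB, h3, nome_pow_five]
    generalize qProdPow (-(3 / 5)) (nome (5 * τ)) = p
    generalize seriesA (nome (5 * τ)) = F
    generalize seriesB (nome (5 * τ)) = G
    linear_combination (-p ^ 2 * nome τ * F * G) * h1 + (p * nome τ * F) ^ 2 * h2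
  refine left_ne_zero_of_mul (b := thetaB (5 * τ) - d * thetaA (5 * τ)) ?_
  rw [h]
  exact mul_ne_zero (pow_ne_zero 2 (qProdPow_ne_zero _ _))
    (mul_ne_zero (qProd_ne_zero hq) (qProd_ne_zero (norm_pow_five_lt_one hq)))

theorem continuousAt_thetaB {τ : ℂ} (hτ : 0 < τ.im) : ContinuousAt thetaB τ := by
  have hq := norm_nome_lt_one hτ
  have hn : ContinuousAt nome τ := continuous_nome.continuousAt
  exact ((differentiableAt_qProdPow (-(3 / 5)) hq).continuousAt.comp hn).mul
    ((differentiableAt_seriesB hq).continuousAt.comp hn)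

theorem continuousAt_thetaA {τ : ℂ} (hτ : 0 < τ.im) : ContinuousAt thetaA τ := by
  have hq := norm_nome_lt_one hτ
  have hn : ContinuousAt nome τ := continuous_nome.continuousAt
  have hn' : ContinuousAt (fun τ : ℂ => nome (τ / 5)) τ :=
    (continuous_nome.comp (by fun_prop : Continuous fun τ : ℂ => τ / 5)).continuousAt
  exact (hn'.mul ((differentiableAt_qProdPow (-(3 / 5)) hq).continuousAt.comp hn)).mul
    ((differentiableAt_seriesA hq).continuousAt.comp hn)

theorem im_div_five_pos (τ : ℍ) : 0 < ((τ : ℂ) / 5).im := by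
  have h := τ.im_pos
  have h1 : ((τ : ℂ) / 5).im = τ.im / 5 := by
    simp
  rw [h1]
  positivity

theorem im_five_mul_pos (τ : ℍ) : 0 < (5 * (τ : ℂ)).im := by
  have h := τ.im_pos
  have h1 : (5 * (τ : ℂ)).im = 5 * τ.im := by simp [Complex.mul_im]
  rw [h1]
  positivity

theorem tendsto_nome_mul {c : ℝ} (hc : 0 < c) :
    Tendsto (fun τ : ℍ => nome (c * τ)) atImInfty (𝓝 0) := by
  rw [tendsto_zero_iff_norm_tendsto_zero]
  simp only [norm_nome, Complex.im_ofReal_mul]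
  have h : Tendsto (fun τ : ℍ => 2 * Real.pi * (c * τ.im)) atImInfty atTop :=
    (tendsto_comap.const_mul_atTop hc).const_mul_atTop Real.two_pi_pos
  exact Real.tendsto_exp_neg_atTop_nhds_zero.comp h

theorem qProdPow_zero_right (s : ℂ) : qProdPow s 0 = 1 := by simp [qProdPow]

theorem tendsto_qProdPow_mul_seriesA {ι : Type*} {l : Filter ι} {f : ι → ℂ}
    (hf : Tendsto f l (𝓝 0)) :
    Tendsto (fun x => qProdPow (-(3 / 5)) (f x) * seriesA (f x)) l (𝓝 1) := by
  have h0 : ‖(0 : ℂ)‖ < 1 := by simp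
  have h := ((differentiableAt_qProdPow (-(3 / 5)) h0).continuousAt.tendsto.comp hf).mul
    ((differentiableAt_seriesA h0).continuousAt.tendsto.comp hf)
  rwa [qProdPow_zero_right, seriesA_zero, one_mul] at h

theorem tendsto_qProdPow_mul_seriesB {ι : Type*} {l : Filter ι} {f : ι → ℂ}
    (hf : Tendsto f l (𝓝 0)) :
    Tendsto (fun x => qProdPow (-(3 / 5)) (f x) * seriesB (f x)) l (𝓝 1) := by
  have h0 : ‖(0 : ℂ)‖ < 1 := by simp
  have h := ((differentiableAt_qProdPow (-(3 / 5)) h0).continuousAt.tendsto.comp hf).mul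
    ((differentiableAt_seriesB h0).continuousAt.tendsto.comp hf)
  rwa [qProdPow_zero_right, seriesB_zero, one_mul] at h

theorem tendsto_nome_div_five : Tendsto (fun τ : ℍ => nome (τ / 5)) atImInfty (𝓝 0) :=
  (tendsto_nome_mul (c := 1 / 5) (by norm_num)).congr fun τ => by
    congr 1; push_cast; ring

theorem tendsto_nome_five_mul : Tendsto (fun τ : ℍ => nome (5 * τ)) atImInfty (𝓝 0) :=
  (tendsto_nome_mul (c := 5) (by norm_num)).congr fun τ => by norm_num

theorem isCalA_thetaA : IsCalA fun τ => thetaA (τ / 5) where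
  continuous := continuous_iff_continuousAt.2 fun τ =>
    ContinuousAt.comp (f := fun τ : ℍ => (τ : ℂ) / 5) (continuousAt_thetaA (im_div_five_pos τ))
      (UpperHalfPlane.continuous_coe.div_const 5).continuousAt
  pow_eq τ := by
    rw [thetaA_pow_five (im_div_five_pos τ), show 5 * ((τ : ℂ) / 5) = τ by ring]
  tendsto := by
    refine (tendsto_qProdPow_mul_seriesA tendsto_nome_div_five).congr fun τ => ?_
    have h : nome ((τ : ℂ) / 5 / 5) = nome (τ / 25) := by congr 1; ring
    rw [thetaA, h, mul_assoc, mul_div_cancel_left₀ _ (nome_ne_zero _)]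

theorem isCalB_thetaB : IsCalB fun τ => thetaB (τ / 5) where
  continuous := continuous_iff_continuousAt.2 fun τ =>
    ContinuousAt.comp (f := fun τ : ℍ => (τ : ℂ) / 5) (continuousAt_thetaB (im_div_five_pos τ))
      (UpperHalfPlane.continuous_coe.div_const 5).continuousAt
  pow_eq τ := by
    rw [thetaB_pow_five (im_div_five_pos τ), show 5 * ((τ : ℂ) / 5) = τ by ring]
  tendsto := by
    simp only [div_one]
    exact tendsto_qProdPow_mul_seriesB tendsto_nome_div_five

theorem isRootBA_thetaB_sub {c : ℝ} (hc : c ^ 2 = c + 1) :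
    IsRootBA c fun τ => thetaB (5 * τ) - c * thetaA (5 * τ) where
  continuous := continuous_iff_continuousAt.2 fun τ =>
    have h5 : ContinuousAt (fun τ : ℍ => 5 * (τ : ℂ)) τ :=
      (continuous_const.mul UpperHalfPlane.continuous_coe).continuousAt
    (ContinuousAt.comp (f := fun τ : ℍ => 5 * (τ : ℂ))
      (continuousAt_thetaB (im_five_mul_pos τ)) h5).sub
      (continuousAt_const.mul (ContinuousAt.comp (f := fun τ : ℍ => 5 * (τ : ℂ))
        (continuousAt_thetaA (im_five_mul_pos τ)) h5))
  pow_eq τ := by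
    rw [sub_mul_pow_five (by exact_mod_cast hc), ← thetaA_pow_five τ.im_pos,
      ← thetaB_pow_five τ.im_pos]
  tendsto := by
    have hA := (tendsto_nome_mul one_pos).mul
      (tendsto_qProdPow_mul_seriesA tendsto_nome_five_mul)
    -- The A-term carries the factor q = `nome τ` and disappears in the limit, leaving 1.
    have h := (tendsto_qProdPow_mul_seriesB tendsto_nome_five_mul).sub (hA.const_mul (c : ℂ))
    rw [zero_mul, mul_zero, sub_zero] at h
    refine h.congr fun τ => ?_
    have h3 : 5 * (τ : ℂ) / 5 = τ := by ring
    rw [div_one, thetaA, thetaB, h3, Complex.ofReal_one, one_mul, mul_assoc (nome τ)]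

/-- The quotient of two branches is a continuous map from the connected half-plane to the finite set
of fifth roots of unity. It is therefore constant, and the common asymptotics make it 1. -/
theorem IsFifthRootBranch.unique {f g F G : ℍ → ℂ} (hF : IsFifthRootBranch f g F)
    (hG : IsFifthRootBranch f g G) (hf : ∀ τ, f τ ≠ 0) (hg : ∀ τ, g τ ≠ 0) : F = G := by
  have hG0 : ∀ τ, G τ ≠ 0 := fun τ h => hf τ (by rw [← hG.pow_eq, h, zero_pow (by norm_num)])
  have hc : Continuous fun τ => F τ / G τ := hF.continuous.div hG.continuous hG0
  have hfin : {z : ℂ | z ^ 5 = 1}.Finite := by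
    refine (Polynomial.nthRoots 5 (1 : ℂ)).toFinset.finite_toSet.subset fun z hz => ?_
    simpa [Polynomial.mem_nthRoots] using hz
  have hconst : ∀ σ τ, F σ / G σ = F τ / G τ := fun σ τ =>
    isPreconnected_univ.constant_of_mapsTo hfin.isDiscrete hc.continuousOn
      (fun τ _ => by
        rw [Set.mem_ofPred_eq, div_pow, hF.pow_eq, hG.pow_eq, div_self (hf τ)])
      (Set.mem_univ σ) (Set.mem_univ τ)
  have hlim : Tendsto (fun τ => F τ / G τ) atImInfty (𝓝 1) := by
    have h := hF.tendsto.div hG.tendsto one_ne_zero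
    rw [div_one] at h
    exact h.congr fun τ => div_div_div_cancel_right₀ (hg τ) _ _
  funext τ
  have h1 : F τ / G τ = 1 :=
    tendsto_nhds_unique (tendsto_const_nhds.congr fun σ => hconst τ σ) hlim
  exact (div_eq_one_iff_eq (hG0 τ)).1 h1

theorem IsCalA.eq_thetaA {F : ℍ → ℂ} (hF : IsCalA F) : F = fun τ : ℍ => thetaA (τ / 5) :=
  hF.unique isCalA_thetaA (fun τ => by
    rw [← isCalA_thetaA.pow_eq]
    exact pow_ne_zero 5 (thetaA_ne_zero (im_div_five_pos τ))) fun _ => nome_ne_zero _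

theorem IsCalB.eq_thetaB {F : ℍ → ℂ} (hF : IsCalB F) : F = fun τ : ℍ => thetaB (τ / 5) :=
  hF.unique isCalB_thetaB (fun τ => by
    rw [← isCalB_thetaB.pow_eq]
    exact pow_ne_zero 5 (thetaB_ne_zero (im_div_five_pos τ))) fun _ => one_ne_zero

theorem IsRootBA.eq_thetaB_sub {c d : ℝ} (h1 : c + d = 1) (h2 : c * d = -1) {F : ℍ → ℂ}
    (hF : IsRootBA c F) : F = fun τ : ℍ => thetaB (5 * τ) - c * thetaA (5 * τ) := by
  have hc : c ^ 2 = c + 1 := by linear_combination c * h1 - h2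
  refine hF.unique (isRootBA_thetaB_sub hc) (fun τ => ?_) fun _ => one_ne_zero
  rw [← (isRootBA_thetaB_sub hc).pow_eq]
  exact pow_ne_zero 5 (thetaB_sub_ne_zero (c := (c : ℂ)) (d := (d : ℂ)) (by exact_mod_cast h1)
    (by exact_mod_cast h2) τ.im_pos)

theorem β_add_α : β + α = 1 := by rw [add_comm, α_add_β]

theorem β_mul_α : β * α = -1 := by rw [mul_comm, α_mul_β]

end QuinticTheta

end

theorem theorem3p3 :
    -- real `q`, real fifth roots: the explicit formulas
    (∀ q : ℝ, |q| < 1 →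
      QuinticTheta.realA (QuinticTheta.fifthRoot q) =
          QuinticTheta.calA (QuinticTheta.realA q) (QuinticTheta.realB q) ∧
      QuinticTheta.realB (QuinticTheta.fifthRoot q) =
          QuinticTheta.calB (QuinticTheta.realA q) (QuinticTheta.realB q) ∧
      QuinticTheta.realA (q ^ 5) =
          QuinticTheta.calC (QuinticTheta.realA q) (QuinticTheta.realB q) ∧
      QuinticTheta.realB (q ^ 5) =
          QuinticTheta.calD (QuinticTheta.realA q) (QuinticTheta.realB q)) ∧
    -- real `q`, real fifth roots: the transformation of relations
    (∀ Ω : ℝ → ℝ → ℝ → ℝ,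
      (∀ q : ℝ, |q| < 1 → Ω q (QuinticTheta.realA q) (QuinticTheta.realB q) = 0) →
      ∀ q : ℝ, |q| < 1 →
        Ω (QuinticTheta.fifthRoot q)
          (QuinticTheta.calA (QuinticTheta.realA q) (QuinticTheta.realB q))
          (QuinticTheta.calB (QuinticTheta.realA q) (QuinticTheta.realB q)) = 0 ∧
        Ω (q ^ 5)
          (QuinticTheta.calC (QuinticTheta.realA q) (QuinticTheta.realB q))
          (QuinticTheta.calD (QuinticTheta.realA q) (QuinticTheta.realB q)) = 0) ∧
    -- complex `q = e^{2πiτ}`: the four fifth roots are well defined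
    (∃! F : ℍ → ℂ, QuinticTheta.IsCalA F) ∧
    (∃! F : ℍ → ℂ, QuinticTheta.IsCalB F) ∧
    (∃! F : ℍ → ℂ, QuinticTheta.IsRootBA QuinticTheta.α F) ∧
    (∃! F : ℍ → ℂ, QuinticTheta.IsRootBA QuinticTheta.β F) ∧
    -- complex `q`: the explicit formulas and the transformation of relations
    (∀ 𝒜 ℬ R S 𝒞 𝒟 : ℍ → ℂ,
      QuinticTheta.IsCalA 𝒜 → QuinticTheta.IsCalB ℬ →
      QuinticTheta.IsRootBA QuinticTheta.α R → QuinticTheta.IsRootBA QuinticTheta.β S →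
      (∀ τ, 𝒞 τ = (R τ - S τ) / (QuinticTheta.β - QuinticTheta.α)) →
      (∀ τ, 𝒟 τ = (QuinticTheta.β * R τ - QuinticTheta.α * S τ) /
        (QuinticTheta.β - QuinticTheta.α)) →
      (∀ τ : ℍ,
        QuinticTheta.thetaA (τ / 5) = 𝒜 τ ∧ QuinticTheta.thetaB (τ / 5) = ℬ τ ∧
        QuinticTheta.thetaA (5 * τ) = 𝒞 τ ∧ QuinticTheta.thetaB (5 * τ) = 𝒟 τ) ∧
      (∀ Ω : ℂ → ℂ → ℂ → ℂ,
        (∀ τ : ℍ, Ω (QuinticTheta.nome τ) (QuinticTheta.thetaA τ) (QuinticTheta.thetaB τ) = 0) →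
        ∀ τ : ℍ,
          Ω (QuinticTheta.nome (τ / 5)) (𝒜 τ) (ℬ τ) = 0 ∧
          Ω (QuinticTheta.nome (5 * τ)) (𝒞 τ) (𝒟 τ) = 0)) := by
  open QuinticTheta in
  refine ⟨fun q hq => ⟨realA_fifthRoot hq, realB_fifthRoot hq, realA_pow hq, realB_pow hq⟩,
    fun Ω h q hq => ?_, ⟨_, isCalA_thetaA, fun F hF => hF.eq_thetaA⟩,
    ⟨_, isCalB_thetaB, fun F hF => hF.eq_thetaB⟩,
    ⟨_, isRootBA_thetaB_sub α_sq, fun F hF => hF.eq_thetaB_sub α_add_β α_mul_β⟩,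
    ⟨_, isRootBA_thetaB_sub β_sq, fun F hF => hF.eq_thetaB_sub β_add_α β_mul_α⟩,
    fun 𝒜 ℬ R S 𝒞 𝒟 hA hB hR hS hC hD => ?_⟩
  -- After the explicit formulas are undone, both claims are the given relation at the points
  -- q^{1/5} and q⁵.
  · rw [← realA_fifthRoot hq, ← realB_fifthRoot hq, ← realA_pow hq, ← realB_pow hq]
    exact ⟨h _ (abs_fifthRoot_lt_one hq), h _ (abs_pow_five_lt_one hq)⟩
  · have hne : (β : ℂ) - α ≠ 0 := by exact_mod_cast β_sub_α_ne_zero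
    have key : ∀ τ : ℍ, thetaA (τ / 5) = 𝒜 τ ∧ thetaB (τ / 5) = ℬ τ ∧
        thetaA (5 * τ) = 𝒞 τ ∧ thetaB (5 * τ) = 𝒟 τ := fun τ => by
      refine ⟨by rw [hA.eq_thetaA], by rw [hB.eq_thetaB], ?_, ?_⟩
      · rw [hC, hR.eq_thetaB_sub α_add_β α_mul_β, hS.eq_thetaB_sub β_add_α β_mul_α,
          eq_div_iff hne]
        ring
      · rw [hD, hR.eq_thetaB_sub α_add_β α_mul_β, hS.eq_thetaB_sub β_add_α β_mul_α,
          eq_div_iff hne]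
        ring
    refine ⟨key, fun Ω h τ => ?_⟩
    obtain ⟨h1, h2, h3, h4⟩ := key τ
    rw [← h1, ← h2, ← h3, ← h4]
    exact ⟨by simpa using h ⟨τ / 5, im_div_five_pos τ⟩,
      by simpa using h ⟨5 * τ, im_five_mul_pos τ⟩⟩
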